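/- Let $K$ be a field, $s\ge 1$, $S=K[t_1,\ldots,t_s]$ and $\mathfrak m=(t_1,\ldots,t_s)$. For $a\in\mathbb Z^s$ write $a=a^+-a^-$ with $a^+,a^-\in\mathbb N^s$ of disjoint supports. Let $L$ be an $s\times m$ integer matrix with columns $a_1,\ldots,a_m$, let $I=I(L)=(t^{a_1^+}-t^{a_1^-},\ldots,t^{a_m^+}-t^{a_m^-})\subset S$ be its matrix ideal, let $\mathcal L\subset\mathbb Z^s$ be the subgroup generated by the columns of $L$, and let $I(\mathcal L)=(t^{a^+}-t^{a^-}\mid a\in\mathcal L)$ be its lattice ideal. Suppose that $I$ is graded (homogeneous for some grading of $S$ in which each $t_i$ has a positive integer weight) and that, for every $i$, the set $V(I,t_i)\subset K^s$ of common zeros of $I$ and $t_i$ is $\{0\}$. An ideal is called unmixed if all its associated primes have the same height. ${\rm Hull}(I)$ is the intersection of the isolated primary components of $I$ (those whose radical is a minimal prime of $I$). $(I:g^\infty)=\bigcup_{k\ge1}(I:g^k)$. For $\mathbf d\in\mathbb N_+^s$ (positive integers), the Herzog ideal $\mathfrak p_{\mathbf d}$ is the kernel of the $K$-algebra map $S\to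 K[x]$, $t_i\mapsto x^{d_i}$. $T(\cdot)$ denotes the torsion subgroup. A primary decomposition is minimal if the radicals of its components are distinct and no component can be omitted. Then there are an integer $c\ge1$ and distinct ideals $\mathfrak q_1,\ldots,\mathfrak q_c$ of $S$, where $\mathfrak q_i$ is $\mathfrak p_i$-primary with ${\rm ht}(\mathfrak p_i)=s-1$, such that the following hold. (a) If $I$ is unmixed, then $I=\mathfrak q_1\cap\cdots\cap\mathfrak q_c$ is a minimal primary decomposition of $I$. If $I$ is not unmixed, then there is an $\mathfrak m$-primary ideal $\mathfrak q$ such that $I=\mathfrak q_1\cap\cdots\cap\mathfrak q_c\cap\mathfrak q$ is a minimal primary decomposition of $I$. (b) For all $g\in\mathfrak m\setminus\bigcup_{i=1}^c\mathfrak p_i$, $$I(\mathcal L)=(I:(t_1\cdots t_s)^\infty)=(I:g^\infty)=\mathfrak q_1\cap\cdots\cap\mathfrak q_c={\rm Hull}(I);$$ the equalities that do not involve $g$ hold unconditionally. (c) ${\rm rank}(L)=s-1$, and there is exactly one ideal of $S$ that is a Herzog ideal $\mathfrak p_{\mathbf d}$ for some $\mathbf d\in\mathbb N_+^s$ and contains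 $I$. (d) If $I$ is not unmixed and $h=t_1\cdots t_s$, there is an integer $a\ge1$ such that $I(\mathcal L)=(I:h^a)$, the ideal $I+(h^a)$ is an irredundant $\mathfrak m$-primary component of $I$ (that is, it is $\mathfrak m$-primary and $\mathfrak q_1\cap\cdots\cap\mathfrak q_c\cap(I+(h^a))$ is a minimal primary decomposition of $I$), and $I=I(\mathcal L)\cap(I+(h^a))$. (e) The group $T(\mathbb Z^s/\mathcal L)$ is finite. If ${\rm char}(K)=0$, then $c\le|T(\mathbb Z^s/\mathcal L)|$, with equality if $K$ is algebraically closed. If ${\rm char}(K)=p$ is a prime, then among the subgroups of $T(\mathbb Z^s/\mathcal L)$ of order relatively prime to $p$ there is a largest one $G$ (containing all the others), and $c\le|G|$, with equality if $K$ is algebraically closed. -/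

import Mathlib

open MvPolynomial

noncomputable section

/-- The binomial `t^{a⁺} - t^{a⁻}` of `K[t_1, …, t_s]`, where `a = a⁺ - a⁻` and `a⁺, a⁻` are
nonnegative vectors with disjoint supports. -/
def vectorBinomial (K : Type*) [Field K] {s : ℕ} (a : Fin s → ℤ) : MvPolynomial (Fin s) K :=
  ∏ i, X i ^ (a i).toNat - ∏ i, X i ^ (-a i).toNat

/-- The matrix ideal of `L`: the ideal generated by the binomials of the columns of `L`. -/
def matrixIdeal (K : Type*) [Field K] {s m : ℕ} (L : Matrix (Fin s) (Fin m) ℤ) :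
    Ideal (MvPolynomial (Fin s) K) :=
  Ideal.span (Set.range fun j : Fin m => vectorBinomial K (L.col j))

/-- The lattice (subgroup of `ℤ^s`) generated by the columns of `L`. -/
def columnLattice {s m : ℕ} (L : Matrix (Fin s) (Fin m) ℤ) : AddSubgroup (Fin s → ℤ) :=
  AddSubgroup.closure (Set.range L.col)

/-- The lattice ideal of a lattice `Λ ⊆ ℤ^s`. -/
def latticeIdeal (K : Type*) [Field K] {s : ℕ} (Λ : AddSubgroup (Fin s → ℤ)) :
    Ideal (MvPolynomial (Fin s) K) :=
  Ideal.span (vectorBinomial K '' (Λ : Set (Fin s → ℤ)))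

/-- The maximal ideal `(t_1, …, t_s)`. -/
def irrelevantIdeal (K : Type*) [Field K] (s : ℕ) : Ideal (MvPolynomial (Fin s) K) :=
  Ideal.span (Set.range X)

/-- `I` is graded: homogeneous for the grading of `K[t_1, …, t_s]` by some weight vector with
positive integer entries. -/
def IsGradedIdeal {K : Type*} [Field K] {s : ℕ} (I : Ideal (MvPolynomial (Fin s) K)) : Prop :=
  ∃ d : Fin s → ℕ, (∀ i, 0 < d i) ∧
    letI := weightedGradedAlgebra K d
    I.IsHomogeneous (weightedHomogeneousSubmodule K d)

/-- The saturation `(I : g^∞) = ⋃_{k ≥ 1} (I : g^k)`. -/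
def idealSaturation {R : Type*} [CommRing R] (I : Ideal R) (g : R) : Ideal R where
  carrier := {f | ∃ k : ℕ, 1 ≤ k ∧ f * g ^ k ∈ I}
  zero_mem' := ⟨1, le_rfl, by simp⟩
  add_mem' := by
    rintro x y ⟨k, hk, hx⟩ ⟨l, hl, hy⟩
    refine ⟨k + l, by omega, ?_⟩
    have e : (x + y) * g ^ (k + l) = g ^ l * (x * g ^ k) + g ^ k * (y * g ^ l) := by ring
    rw [e]
    exact I.add_mem (I.mul_mem_left _ hx) (I.mul_mem_left _ hy)
  smul_mem' := by
    rintro c x ⟨k, hk, hx⟩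
    refine ⟨k, hk, ?_⟩
    rw [smul_eq_mul, mul_assoc]
    exact I.mul_mem_left c hx

/-- `I` is unmixed: all its associated primes have the same height. -/
def IsUnmixedIdeal {R : Type*} [CommRing R] (I : Ideal R) : Prop :=
  ∀ p ∈ associatedPrimes R (R ⧸ I), ∀ p' ∈ associatedPrimes R (R ⧸ I), p.height = p'.height

/-- `q` is an isolated primary component of `I`: a member of a minimal primary decomposition of `I`
whose radical is a minimal prime of `I`. -/
def IsIsolatedComponent {R : Type*} [CommRing R] (I q : Ideal R) : Prop :=
  (∃ t : Finset (Ideal R), Submodule.IsMinimalPrimaryDecomposition I t ∧ q ∈ t) ∧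
    q.radical ∈ I.minimalPrimes

/-- The hull of `I`: the intersection of the isolated primary components of `I`. (In a Noetherian
ring these components do not depend on the chosen decomposition.) -/
def idealHull {R : Type*} [CommRing R] (I : Ideal R) : Ideal R :=
  sInf {q | IsIsolatedComponent I q}

/-- `t ∪ {q}` is a minimal primary decomposition of `I`, where `q` is `M`-primary and `q ∉ t`. -/
def IsMinimalDecompositionWith {R : Type*} [CommRing R] (I : Ideal R) (t : Finset (Ideal R))
    (M q : Ideal R) : Prop :=
  q.IsPrimary ∧ q.radical = M ∧ q ∉ t ∧ Submodule.IsMinimalPrimaryDecomposition I (insert q t)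

/-- The Herzog ideal of `d`: the toric ideal of `K[x^{d_1}, …, x^{d_s}]`, that is, the kernel of
the `K`-algebra map `K[t_1, …, t_s] → K[x]` with `t_i ↦ x^{d_i}`. -/
def herzogIdeal (K : Type*) [Field K] {s : ℕ} (d : Fin s → ℕ) : Ideal (MvPolynomial (Fin s) K) :=
  RingHom.ker (aeval (R := K) fun i => (Polynomial.X : Polynomial K) ^ d i)

/-- `P` is the Herzog ideal of some vector of positive integers. -/
def IsHerzogIdeal {K : Type*} [Field K] {s : ℕ} (P : Ideal (MvPolynomial (Fin s) K)) : Prop :=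
  ∃ d : Fin s → ℕ, (∀ i, 0 < d i) ∧ P = herzogIdeal K d

/-- The torsion subgroup `T(ℤ^s / Λ)`. -/
abbrev latticeTorsion {s : ℕ} (Λ : AddSubgroup (Fin s → ℤ)) : AddSubgroup ((Fin s → ℤ) ⧸ Λ) :=
  AddCommGroup.torsion ((Fin s → ℤ) ⧸ Λ)

end

/-! ### Primary decompositions, saturation and hull -/

section PrimaryDecomposition

variable {R : Type*} [CommRing R]

/-! Write `J` for the lattice ideal and `Λ` for the column lattice. All of `I` vanishes at `(1, …,
1)`, so `I` contains no monomial; hence a grading making `I` homogeneous is a positive weight vector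
`d` that kills `Λ`. The condition on `V(I, t_i)` makes every linear form killing `Λ` proportional to
`d` (`proportional_of_zeroLocus`). So `ker d` is the saturation of `Λ`, which gives the rank and the
unique Herzog ideal.

For a primitive multiple `k` of the weights, `ℤ^s = ker k ⊕ ℤx` with `k(x) = 1`, and `ker k / Λ` is
the torsion group `T`. The resulting `π : ℤ^s → T` presents `Λ` as the common kernel of `k` and `π`,
so `J` is the kernel of `t^u ↦ [π u] x^{k·u}` into `K[T][x]` (`latticeIdeal_eq_ker`). A nonzero
`f(t_i)` is sent to a polynomial with unit leading coefficient, a nonzerodivisor. Hence `J = (I :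
h^∞)` for `h = t_1⋯t_s`, and associated primes of `J` meet each `K[t_i]` in zero. As `J` also
contains binomials `t_i^N - t_0^M`, such primes become maximal over `K(t_0)`, so all have height `s
- 1`.

A prime containing `I` and `h` equals `𝔪`, so `I + (h^a)` is `𝔪`-primary, and for large `a` one has
`I = J ∩ (I + (h^a))`. Thus `I` is unmixed exactly when `I = J`; parts (a), (b) and (d) follow from
a minimal decomposition of `J`.

For the count, take `Γ = T`, or the prime-to-`p` part of `T` in characteristic `p`, where
injectivity of Frobenius discards the rest. Each minimal prime of `J` comes from a prime of `K[Γ]`,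
and there are at most `dim K[Γ] = |Γ|` of those. Over an algebraically closed field the `|Γ|`
characters `Γ → Kˣ` give distinct primes of height `s - 1` over `J`. -/

theorem mem_associatedPrimes_quotient_iff {I p : Ideal R} :
    p ∈ associatedPrimes R (R ⧸ I) ↔ p ∈ Submodule.associatedPrimes I := by
  have key : ∀ x : R, Submodule.colon (⊥ : Submodule R (R ⧸ I)) {Ideal.Quotient.mk I x} =
      Submodule.colon I {x} := by
    intro x
    ext r
    rw [Submodule.mem_colon_singleton, Submodule.mem_colon_singleton, Submodule.mem_bot,
      smul_eq_mul, ← Ideal.Quotient.eq_zero_iff_mem, map_mul]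
    rfl
  constructor
  · rintro ⟨hp, y, hy⟩
    obtain ⟨x, rfl⟩ := Ideal.Quotient.mk_surjective y
    exact ⟨hp, x, by rw [hy, key]⟩
  · rintro ⟨hp, x, hx⟩
    exact ⟨hp, Ideal.Quotient.mk I x, by rw [hx, key]⟩

theorem Submodule.IsMinimalPrimaryDecomposition.mem_associatedPrimes_quotient_iff
    {I p : Ideal R} {t : Finset (Ideal R)} (ht : Submodule.IsMinimalPrimaryDecomposition I t) :
    p ∈ associatedPrimes R (R ⧸ I) ↔ ∃ q ∈ t, q.radical = p := by
  rw [_root_.mem_associatedPrimes_quotient_iff, ← ht.image_radical_eq_associated_primes]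
  simp [Submodule.colon_univ]

theorem Submodule.IsMinimalPrimaryDecomposition.eq_of_radical_eq
    {I : Ideal R} {t : Finset (Ideal R)} (ht : Submodule.IsMinimalPrimaryDecomposition I t)
    {q q' : Ideal R} (hq : q ∈ t) (hq' : q' ∈ t) (h : q.radical = q'.radical) : q = q' := by
  by_contra hne
  exact ht.distinct hq hq' hne (by simpa [Function.onFun, Submodule.colon_univ] using h)

/-- A component with minimal radical is the set of elements multiplied into the ideal by some
element outside that radical. -/
theorem Submodule.IsMinimalPrimaryDecomposition.mem_iff_of_minimal
    {I : Ideal R} {t : Finset (Ideal R)} (ht : Submodule.IsMinimalPrimaryDecomposition I t)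
    {q : Ideal R} (hq : q ∈ t) (hmin : q.radical ∈ I.minimalPrimes) {f : R} :
    f ∈ q ↔ ∃ g, g ∉ q.radical ∧ f * g ∈ I := by
  have hprim := ht.primary hq
  have hp : q.radical.IsPrime := Ideal.isPrime_radical hprim
  constructor
  · intro hf
    -- Prime avoidance: otherwise another component has its radical inside the minimal prime
    -- `q.radical`, hence equal to it. So some `g` outside `q.radical` lies in all other components.
    have hnot : ¬ (t.erase q).inf id ≤ q.radical := by
      intro hle
      obtain ⟨q', hq', hle'⟩ := (Ideal.IsPrime.inf_le' hp).mp hle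
      obtain ⟨hne, hq't⟩ := Finset.mem_erase.mp hq'
      have hrad : q'.radical ≤ q.radical := hp.radical_le_iff.mpr hle'
      have hI : I ≤ q'.radical :=
        (ht.inf_eq.symm.le.trans (Finset.inf_le hq't)).trans Ideal.le_radical
      have := hmin.2 ⟨Ideal.isPrime_radical (ht.primary hq't), hI⟩ hrad
      exact hne (ht.eq_of_radical_eq hq't hq (le_antisymm hrad this))
    obtain ⟨g, hg, hgq⟩ := SetLike.not_le_iff_exists.mp hnot
    refine ⟨g, hgq, ?_⟩
    rw [← ht.inf_eq, ← Finset.insert_erase hq, Finset.inf_insert]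
    exact ⟨Ideal.mul_mem_right _ _ hf, Ideal.mul_mem_left _ _ hg⟩
  · rintro ⟨g, hg, hfg⟩
    have : f * g ∈ q := (ht.inf_eq.symm.le.trans (Finset.inf_le hq)) hfg
    exact ((Ideal.isPrimary_iff.mp hprim).2 this).resolve_right hg

theorem exists_colon_eq_idealSaturation [IsNoetherianRing R] (I : Ideal R) (h : R) :
    ∃ a : ℕ, 0 < a ∧ idealSaturation I h = Submodule.colon I {h ^ a} := by
  let F : ℕ →o Ideal R :=
    ⟨fun k => Submodule.colon I {h ^ k}, fun k l hkl x hx => by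
      rw [Submodule.mem_colon_singleton, smul_eq_mul] at hx ⊢
      obtain ⟨c, rfl⟩ := Nat.exists_eq_add_of_le hkl
      rw [pow_add, ← mul_assoc]
      exact I.mul_mem_right _ hx⟩
  obtain ⟨N, hN⟩ := monotone_stabilizes_iff_noetherian.mpr ‹IsNoetherianRing R› F
  -- `N + 1` rather than `N`, so that the exponent is positive even if the chain is constant from
  -- the start.
  refine ⟨N + 1, N.succ_pos, le_antisymm ?_ ?_⟩
  · rintro x ⟨k, -, hx⟩
    have h1 : x ∈ F (N + 1 + k) := F.monotone (by omega : k ≤ N + 1 + k)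
      (Submodule.mem_colon_singleton.mpr hx)
    have h2 : F (N + 1) = F (N + 1 + k) :=
      (hN (N + 1) (by omega)).symm.trans (hN (N + 1 + k) (by omega))
    rwa [← h2] at h1
  · intro x hx
    exact ⟨N + 1, by omega, Submodule.mem_colon_singleton.mp hx⟩

/-- If `i + h^a g` is killed by `h^a` modulo `I`, then `g h^{2a} ∈ I`; since `(I : h^a)` is already
the full saturation, `g h^a ∈ I`. -/
theorem eq_saturation_inf_sup_span {I : Ideal R} {h : R} {a : ℕ}
    (ha : idealSaturation I h = Submodule.colon I {h ^ a}) (ha0 : 0 < a) :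
    I = idealSaturation I h ⊓ (I ⊔ Ideal.span {h ^ a}) := by
  refine le_antisymm (le_inf ?_ le_sup_left) ?_
  · intro x hx
    exact ⟨1, le_rfl, I.mul_mem_right _ hx⟩
  · rintro x ⟨hx, hx'⟩
    obtain ⟨i, hi, y, hy, rfl⟩ := Submodule.mem_sup.mp hx'
    obtain ⟨g, rfl⟩ := Ideal.mem_span_singleton.mp hy
    have h1 : (i + h ^ a * g) * h ^ a ∈ I := by
      have : i + h ^ a * g ∈ Submodule.colon I {h ^ a} := ha ▸ hx
      exact Submodule.mem_colon_singleton.mp this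
    have h2 : g * h ^ (a + a) ∈ I := by
      have e : g * h ^ (a + a) = (i + h ^ a * g) * h ^ a - i * h ^ a := by ring
      rw [e]
      exact I.sub_mem h1 (I.mul_mem_right _ hi)
    have h3 : g ∈ Submodule.colon I {h ^ a} := ha ▸ (⟨a + a, by omega, h2⟩ : g ∈ idealSaturation I h)
    have h4 : g * h ^ a ∈ I := Submodule.mem_colon_singleton.mp h3
    exact I.add_mem hi (by rwa [mul_comm])

theorem radical_sup_span_pow_eq {I M : Ideal R} [hM : M.IsMaximal] {h : R} (hIM : I ≤ M) (hhM : h ∈ M)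
    (hrad : ∀ Q : Ideal R, Q.IsPrime → I ≤ Q → h ∈ Q → Q = M) {a : ℕ} (ha : 0 < a) :
    (I ⊔ Ideal.span {h ^ a}).radical = M := by
  refine le_antisymm ?_ ?_
  · refine hM.isPrime.radical_le_iff.mpr (sup_le hIM ?_)
    rw [Ideal.span_singleton_le_iff_mem]
    exact Ideal.pow_mem_of_mem _ hhM _ ha
  · rw [Ideal.radical_eq_sInf]
    refine le_sInf ?_
    rintro Q ⟨hQ, hQp⟩
    refine (hrad Q hQp (le_sup_left.trans hQ) (hQp.mem_of_pow_mem a (hQ ?_))).ge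
    exact Ideal.mem_sup_right (Ideal.mem_span_singleton_self _)

theorem isPrimary_sup_span_pow {I M : Ideal R} [hM : M.IsMaximal] {h : R} (hIM : I ≤ M) (hhM : h ∈ M)
    (hrad : ∀ Q : Ideal R, Q.IsPrime → I ≤ Q → h ∈ Q → Q = M) {a : ℕ} (ha : 0 < a) :
    (I ⊔ Ideal.span {h ^ a}).IsPrimary := by
  apply Ideal.isPrimary_of_isMaximal_radical
  rw [radical_sup_span_pow_eq hIM hhM hrad ha]
  exact hM

theorem Submodule.IsMinimalPrimaryDecomposition.nonempty {J : Ideal R} {t : Finset (Ideal R)}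
    (ht : Submodule.IsMinimalPrimaryDecomposition J t) (hJ : J ≠ ⊤) : t.Nonempty := by
  rw [Finset.nonempty_iff_ne_empty]
  rintro rfl
  exact hJ (by simpa using ht.inf_eq.symm)

variable {I J M : Ideal R} {n : ℕ∞} {t : Finset (Ideal R)}

theorem Submodule.IsMinimalPrimaryDecomposition.radical_le_imp_eq [IsNoetherianRing R]
    (ht : Submodule.IsMinimalPrimaryDecomposition J t) (htn : ∀ q ∈ t, q.radical.height = n)
    {q q' : Ideal R} (hq : q ∈ t) (hq' : q' ∈ t) (h : q.radical ≤ q'.radical) : q = q' := by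
  have := Ideal.isPrime_radical (ht.primary hq)
  exact ht.eq_of_radical_eq hq hq' 
    (Ideal.eq_of_le_of_height_le _ h ((htn q' hq').trans (htn q hq).symm).le)

/-- Primes of the same height `n` are incomparable, and the maximal ideal `M` lies in none of them,
so no member of `t` can be dropped. Dropping `Q` would give `I = J`. -/
theorem Submodule.IsMinimalPrimaryDecomposition.isMinimalDecompositionWith [IsNoetherianRing R]
    (ht : Submodule.IsMinimalPrimaryDecomposition J t) (htn : ∀ q ∈ t, q.radical.height = n)
    [hM : M.IsMaximal] (hMn : M.height ≠ n) {Q : Ideal R} (hQ : Q.IsPrimary) (hQM : Q.radical = M)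
    (hIJ : I ≠ J) (hI : I = J ⊓ Q) : IsMinimalDecompositionWith I t M Q := by
  have hQt : Q ∉ t := fun h => hMn (hQM ▸ htn Q h)
  refine ⟨hQ, hQM, hQt, ?_, ?_, ?_, ?_⟩
  · rw [Finset.inf_insert, ht.inf_eq, hI, inf_comm]
    rfl
  · intro q hq
    rcases Finset.mem_insert.mp hq with rfl | hq
    · exact hQ
    · exact ht.primary hq
  · rw [Finset.coe_insert]
    refine ht.distinct.insert fun (q : Ideal R) hq _ => ?_
    have hne : M ≠ q.radical := fun h => hMn (h ▸ htn q hq)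
    simp only [Function.onFun, Submodule.colon_univ, hQM]
    exact ⟨hne, hne.symm⟩
  · intro (q : Ideal R) hq hle
    rcases Finset.mem_insert.mp hq with rfl | hqt
    · rw [Finset.erase_insert hQt, ht.inf_eq] at hle
      exact hIJ (hI.trans (inf_eq_left.mpr hle))
    · have hp : q.radical.IsPrime := Ideal.isPrime_radical (ht.primary hqt)
      obtain ⟨(q' : Ideal R), hq', hle'⟩ := (Ideal.IsPrime.inf_le' hp).mp (hle.trans Ideal.le_radical)
      have hrad : q'.radical ≤ q.radical := hp.radical_le_iff.mpr hle'
      obtain ⟨hne, hq'⟩ := Finset.mem_erase.mp hq'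
      rcases Finset.mem_insert.mp hq' with rfl | hq't
      · rw [hQM] at hrad
        exact hMn (hM.eq_of_le hp.ne_top hrad ▸ htn q hqt)
      · exact hne (ht.radical_le_imp_eq htn hq't hqt hrad)

theorem Submodule.IsMinimalPrimaryDecomposition.isUnmixedIdeal
    (ht : Submodule.IsMinimalPrimaryDecomposition J t) (htn : ∀ q ∈ t, q.radical.height = n) :
    IsUnmixedIdeal J := by
  intro p hp p' hp'
  obtain ⟨q, hq, rfl⟩ := ht.mem_associatedPrimes_quotient_iff.mp hp
  obtain ⟨q', hq', rfl⟩ := ht.mem_associatedPrimes_quotient_iff.mp hp'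
  rw [htn q hq, htn q' hq']

theorem IsMinimalDecompositionWith.not_isUnmixedIdeal {Q : Ideal R}
    (h : IsMinimalDecompositionWith I t M Q) (hne : t.Nonempty)
    (htn : ∀ q ∈ t, q.radical.height = n) (hMn : M.height ≠ n) : ¬ IsUnmixedIdeal I := by
  obtain ⟨-, rfl, -, hdec⟩ := h
  obtain ⟨q, hq⟩ := hne
  intro hun
  refine hMn ((hun _ (hdec.mem_associatedPrimes_quotient_iff.mpr
    ⟨Q, Finset.mem_insert_self _ _, rfl⟩) _ (hdec.mem_associatedPrimes_quotient_iff.mpr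
    ⟨q, Finset.mem_insert_of_mem hq, rfl⟩)).trans (htn q hq))

theorem eq_idealSaturation_of_mem_of_notMem (ht : Submodule.IsMinimalPrimaryDecomposition J t)
    {Q : Ideal R} (hQM : Q.radical = M) (hI : I = J ⊓ Q) {g : R} (hgM : g ∈ M)
    (hg : ∀ q ∈ t, g ∉ q.radical) : J = idealSaturation I g := by
  refine le_antisymm ?_ ?_
  · intro f hf
    rw [← hQM] at hgM
    obtain ⟨k, hk⟩ := hgM
    refine ⟨k + 1, by omega, ?_⟩
    rw [hI]
    refine ⟨J.mul_mem_right _ hf, Q.mul_mem_left _ ?_⟩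
    rw [pow_succ]
    exact Q.mul_mem_right _ hk
  · rintro f ⟨k, -, hf⟩
    rw [← ht.inf_eq]
    refine Submodule.mem_finsetInf.mpr fun (q : Ideal R) hq => ?_
    have h1 : f * g ^ k ∈ q :=
      ((hI.le.trans inf_le_left).trans (ht.inf_eq.symm.le.trans (Finset.inf_le hq))) hf
    have hp : q.radical.IsPrime := Ideal.isPrime_radical (ht.primary hq)
    exact ((Ideal.isPrimary_iff.mp (ht.primary hq)).2 h1).resolve_right
      fun h => hg q hq (hp.mem_of_pow_mem k h)

/-- `M` lies over some radical from `t` of a different height, so it is not a minimal prime of `I`.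
The isolated components are then exactly the members of `t`, whichever decomposition they come from,
by `mem_iff_of_minimal`. -/
theorem eq_idealHull [IsNoetherianRing R] (ht : Submodule.IsMinimalPrimaryDecomposition J t)
    (htn : ∀ q ∈ t, q.radical.height = n) [hM : M.IsMaximal] (hMn : M.height ≠ n) (hJM : J ≤ M)
    {u : Finset (Ideal R)} (hu : Submodule.IsMinimalPrimaryDecomposition I u) (htu : t ⊆ u)
    (hut : ∀ q ∈ u, q ∈ t ∨ q.radical = M) : J = idealHull I := by
  have hlt : ∃ q ∈ t, q.radical ≤ M := by
    obtain ⟨q, hq, hle⟩ := (Ideal.IsPrime.inf_le' hM.isPrime).mp (ht.inf_eq.le.trans hJM)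
    exact ⟨q, hq, hM.isPrime.radical_le_iff.mpr hle⟩
  have hIu : ∀ q ∈ u, I ≤ q.radical := fun q hq =>
    (hu.inf_eq.symm.le.trans (Finset.inf_le hq)).trans Ideal.le_radical
  have hminM : M ∉ I.minimalPrimes := by
    intro h
    obtain ⟨q, hq, hle⟩ := hlt
    have := h.2 ⟨Ideal.isPrime_radical (ht.primary hq), hIu q (htu hq)⟩ hle
    exact hMn (le_antisymm this hle ▸ htn q hq)
  have hmin : ∀ p ∈ I.minimalPrimes, ∃ q ∈ t, q.radical = p := by
    intro p hp
    obtain ⟨q, hq, rfl⟩ := Ideal.IsMinimalPrimaryDecomposition.minimalPrimes_subset_image_radical hu hp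
    rcases hut q hq with h | h
    · exact ⟨q, h, rfl⟩
    · exact absurd (h ▸ hp) hminM
  have hset : {q | IsIsolatedComponent I q} = (t : Set (Ideal R)) := by
    ext q
    constructor
    · rintro ⟨⟨u', hu', hq⟩, hqmin⟩
      obtain ⟨q₀, hq₀, hrad⟩ := hmin _ hqmin
      have : q = q₀ := by
        ext f
        rw [hu'.mem_iff_of_minimal hq hqmin, hu.mem_iff_of_minimal (htu hq₀) (hrad ▸ hqmin), hrad]
      exact this ▸ hq₀
    · intro hq
      refine ⟨⟨u, hu, htu hq⟩, ?_⟩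
      have := Ideal.isPrime_radical (ht.primary hq)
      obtain ⟨p, hp, hle⟩ := Ideal.exists_minimalPrimes_le (hIu q (htu hq))
      obtain ⟨q', hq', rfl⟩ := hmin p hp
      rwa [← ht.radical_le_imp_eq htn hq' hq hle]
  rw [idealHull, hset, ← ht.inf_eq, Finset.inf_id_eq_sInf]

end PrimaryDecomposition

/-! ### Heights of primes in polynomial rings -/

section Height

/-- Over a Jacobson ring a maximal ideal contracts to a maximal ideal, and passing from the
contraction to it raises the height by one. -/
theorem Polynomial.height_of_isMaximal_of_isJacobsonRing {A : Type*} [CommRing A]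
    [IsNoetherianRing A] [IsJacobsonRing A] (k : ℕ)
    (hA : ∀ Q : Ideal A, Q.IsMaximal → Q.height = k) (P : Ideal (Polynomial A)) [P.IsMaximal] :
    P.height = k + 1 := by
  have : (P.under A).IsMaximal := Polynomial.isMaximal_comap_C_of_isJacobsonRing P
  rw [Polynomial.height_eq_height_add_one (P.under A) P, hA _ this]

theorem MvPolynomial.height_of_isMaximal {L : Type*} [Field L] :
    ∀ {n : ℕ} (P : Ideal (MvPolynomial (Fin n) L)), P.IsMaximal → P.height = n
  | 0, P, _ => by
    have h : P.height ≤ ringKrullDim (MvPolynomial (Fin 0) L) :=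
      Ideal.height_le_ringKrullDim_of_ne_top Ideal.IsPrime.ne_top'
    simpa using h
  | n + 1, P, hP => by
    let e := (MvPolynomial.finSuccEquiv L n).toRingEquiv
    have hP' : (P.comap e.symm).IsMaximal := Ideal.comap_isMaximal_of_equiv e.symm
    rw [← RingEquiv.height_comap e.symm P,
      Polynomial.height_of_isMaximal_of_isJacobsonRing n
        (fun Q hQ => MvPolynomial.height_of_isMaximal Q hQ) (P.comap e.symm)]
    push_cast
    rfl

attribute [local instance] MvPolynomial.algebraMvPolynomial in
/-- A prime of `A[t_1, …, t_n]` over the zero ideal of the domain `A`, modulo which some power of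
each variable is a constant, has height `n`. -/
theorem MvPolynomial.height_eq_of_pow_sub_C_mem {A : Type*} [CommRing A] [IsDomain A]
    (L : Type*) [Field L] [Algebra A L] [IsFractionRing A L] {n : ℕ}
    (P : Ideal (MvPolynomial (Fin n) A)) [hP : P.IsPrime] (hC : ∀ a : A, C a ∈ P → a = 0)
    (hX : ∀ i, ∃ N : ℕ, 0 < N ∧ ∃ c : A, X i ^ N - C c ∈ P) : P.height = n := by
  let M := (nonZeroDivisors A).map (C : A →+* MvPolynomial (Fin n) A)
  have hloc : IsLocalization M (MvPolynomial (Fin n) L) := MvPolynomial.isLocalization _ _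
  have hdisj : Disjoint (M : Set (MvPolynomial (Fin n) A)) (P : Set (MvPolynomial (Fin n) A)) := by
    rw [Set.disjoint_left]
    rintro _ ⟨a, ha, rfl⟩ haP
    exact nonZeroDivisors.ne_zero ha (hC a haP)
  let Q : Ideal (MvPolynomial (Fin n) L) := P.map (algebraMap _ _)
  have hQ : Q.IsPrime := IsLocalization.isPrime_of_isPrime_disjoint M _ P hP hdisj
  rw [← IsLocalization.height_map_of_disjoint M P hdisj (S := MvPolynomial (Fin n) L)]
  refine MvPolynomial.height_of_isMaximal Q ?_
  -- Localizing at the nonzero constants preserves the height. The quotient by `Q` is a domain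
  -- generated by integral elements over the field `L`, hence a field.
  have hint : ∀ i, IsIntegral L (Ideal.Quotient.mk Q (X i)) := by
    intro i
    obtain ⟨N, hN, c, hc⟩ := hX i
    refine IsIntegral.of_pow hN ?_
    have h1 : (X i ^ N - C (algebraMap A L c) : MvPolynomial (Fin n) L) ∈ Q := by
      have := Ideal.mem_map_of_mem (algebraMap (MvPolynomial (Fin n) A) (MvPolynomial (Fin n) L)) hc
      rwa [map_sub, map_pow, MvPolynomial.algebraMap_def, MvPolynomial.map_X,
      MvPolynomial.map_C] at this
    rw [← map_pow, Ideal.Quotient.eq.mpr h1]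
    exact isIntegral_algebraMap (R := L) (A := MvPolynomial (Fin n) L ⧸ Q)
  have hall : Algebra.IsIntegral L (MvPolynomial (Fin n) L ⧸ Q) := by
    refine ⟨fun y => ?_⟩
    obtain ⟨f, rfl⟩ := Ideal.Quotient.mk_surjective y
    induction f using MvPolynomial.induction_on with
    | C a => exact isIntegral_algebraMap (R := L) (A := MvPolynomial (Fin n) L ⧸ Q)
    | add f g hf hg => rw [map_add]; exact hf.add hg
    | mul_X f i hf => rw [map_mul]; exact hf.mul (hint i)
  exact Ideal.Quotient.maximal_of_isField _
    (isField_of_isIntegral_of_isField' (Field.toIsField L))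

/-- Regard the ring as `K[t_0][t_1, …, t_n]`: powers of `t_0` become constants, and the previous
theorem applies. -/
theorem MvPolynomial.height_eq_of_pow_sub_pow_mem {K : Type*} [Field K] {n : ℕ}
    (P : Ideal (MvPolynomial (Fin (n + 1)) K)) [hP : P.IsPrime]
    (h0 : ∀ f : Polynomial K, Polynomial.aeval (X 0 : MvPolynomial (Fin (n + 1)) K) f ∈ P → f = 0)
    (hX : ∀ i, ∃ N : ℕ, 0 < N ∧ ∃ k : ℕ, X i ^ N - X 0 ^ k ∈ P) : P.height = n := by
  let e : MvPolynomial (Fin (n + 1)) K ≃ₐ[K] MvPolynomial (Fin n) (Polynomial K) :=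
    (renameEquiv K (_root_.finSuccEquiv n)).trans (optionEquivRight K (Fin n))
  have e0 : e (X 0) = C Polynomial.X := by
    simp [e]
  have eS : ∀ i : Fin n, e (X i.succ) = X i := by
    intro i
    simp [e]
  have eC : ∀ f : Polynomial K, e (Polynomial.aeval (X 0) f) = C f := by
    intro f
    have h : e.toAlgHom.comp (Polynomial.aeval (X 0)) =
        IsScalarTower.toAlgHom K (Polynomial K) (MvPolynomial (Fin n) (Polynomial K)) := by
      ext
      simp [e0, MvPolynomial.algebraMap_eq]
    exact congrArg (fun φ => φ f) h
  have hmem : ∀ f, e f ∈ P.comap e.toRingEquiv.symm ↔ f ∈ P := by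
    intro f
    rw [Ideal.mem_comap]
    simp
  have hP' : (P.comap e.toRingEquiv.symm).IsPrime := Ideal.comap_isPrime _ _
  rw [← RingEquiv.height_comap e.toRingEquiv.symm P]
  refine MvPolynomial.height_eq_of_pow_sub_C_mem (FractionRing (Polynomial K)) _ ?_ ?_
  · intro a ha
    rw [← eC, hmem] at ha
    exact h0 a ha
  · intro i
    obtain ⟨N, hN, k, hk⟩ := hX i.succ
    refine ⟨N, hN, Polynomial.X ^ k, ?_⟩
    rw [← hmem] at hk
    simpa [e0, eS] using hk

end Height

/-! ### Weight vectors killing the columns, and Herzog ideals -/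

section Weights

variable {s : ℕ}

/-- The linear form on `ℤ^s` with nonnegative coefficients `k`. -/
def weightForm (k : Fin s → ℕ) : (Fin s → ℤ) →ₗ[ℤ] ℤ :=
  ∑ i, (k i : ℤ) • LinearMap.proj i

theorem weightForm_apply (k : Fin s → ℕ) (a : Fin s → ℤ) :
    weightForm k a = ∑ i, (k i : ℤ) * a i := by
  simp [weightForm]

theorem weightForm_single (k : Fin s → ℕ) (i : Fin s) (c : ℤ) :
    weightForm k (Pi.single i c) = k i * c := by
  rw [weightForm_apply, Finset.sum_eq_single i] <;> simp +contextual

theorem sum_mul_toNat_sub (k : Fin s → ℕ) (a : Fin s → ℤ) :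
    (∑ i, (k i * (a i).toNat : ℕ) : ℤ) - (∑ i, (k i * (-a i).toNat : ℕ) : ℤ) = weightForm k a := by
  rw [weightForm_apply, ← Finset.sum_sub_distrib]
  refine Finset.sum_congr rfl fun i _ => ?_
  push_cast
  rw [← mul_sub]
  congr 1
  omega

theorem weightForm_eq_zero_iff (k : Fin s → ℕ) (a : Fin s → ℤ) :
    weightForm k a = 0 ↔ ∑ i, k i * (a i).toNat = ∑ i, k i * (-a i).toNat := by
  rw [← sum_mul_toNat_sub, sub_eq_zero]
  exact_mod_cast Iff.rfl

variable {K : Type*} [Field K]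

theorem aeval_pow_prod (k u : Fin s → ℕ) :
    aeval (R := K) (fun i => (Polynomial.X : Polynomial K) ^ k i) (∏ i, X i ^ u i) =
      Polynomial.X ^ (∑ i, k i * u i) := by
  simp [map_prod, ← pow_mul, Finset.prod_pow_eq_pow_sum]

theorem vectorBinomial_mem_herzogIdeal_iff {k : Fin s → ℕ} {a : Fin s → ℤ} :
    vectorBinomial K a ∈ herzogIdeal K k ↔ weightForm k a = 0 := by
  rw [herzogIdeal, RingHom.mem_ker, vectorBinomial, map_sub, aeval_pow_prod, aeval_pow_prod,
    weightForm_eq_zero_iff, sub_eq_zero]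
  exact ⟨fun h => by simpa using congrArg Polynomial.natDegree h, fun h => by rw [h]⟩

/-- Scaling the weights by `N` composes the map with the injection `x ↦ x^N`. -/
theorem herzogIdeal_mul (N : ℕ) (hN : 0 < N) (k : Fin s → ℕ) :
    herzogIdeal K (fun i => N * k i) = herzogIdeal K k := by
  have h : aeval (R := K) (fun i => (Polynomial.X : Polynomial K) ^ (N * k i)) =
      (Polynomial.expand K N).comp (aeval (R := K) fun i => (Polynomial.X : Polynomial K) ^ k i) := by
    ext i
    simp [pow_mul]
  ext f
  rw [herzogIdeal, herzogIdeal, RingHom.mem_ker, RingHom.mem_ker, h, AlgHom.comp_apply,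
    map_eq_zero_iff _ (Polynomial.expand_injective hN)]

variable {m : ℕ} {L : Matrix (Fin s) (Fin m) ℤ}

theorem matrixIdeal_le_herzogIdeal_iff {k : Fin s → ℕ} :
    matrixIdeal K L ≤ herzogIdeal K k ↔ ∀ j, weightForm k (L.col j) = 0 := by
  rw [matrixIdeal, Ideal.span_le, Set.range_subset_iff]
  exact forall_congr' fun j => vectorBinomial_mem_herzogIdeal_iff

theorem eval_one_of_mem_matrixIdeal {f : MvPolynomial (Fin s) K} (hf : f ∈ matrixIdeal K L) :
    eval (fun _ => (1 : K)) f = 0 := by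
  have : matrixIdeal K L ≤ RingHom.ker (eval fun _ : Fin s => (1 : K)) := by
    rw [matrixIdeal, Ideal.span_le, Set.range_subset_iff]
    intro j
    simp [RingHom.mem_ker, vectorBinomial, map_prod]
  exact this hf

theorem prod_X_pow_mem_weightedHomogeneousSubmodule (d u : Fin s → ℕ) :
    (∏ i, X i ^ u i : MvPolynomial (Fin s) K) ∈
      weightedHomogeneousSubmodule K d (∑ i, d i * u i) := by
  rw [mem_weightedHomogeneousSubmodule]
  refine IsWeightedHomogeneous.prod _ _ _ fun i _ => ?_
  have := (isWeightedHomogeneous_X K d i).pow (u i)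
  rwa [smul_eq_mul, mul_comm] at this

/-- A grading for which the matrix ideal is homogeneous has all columns in its kernel. -/
theorem weightForm_col_eq_zero {d : Fin s → ℕ}
    (hd : letI := weightedGradedAlgebra K d
      (matrixIdeal K L).IsHomogeneous (weightedHomogeneousSubmodule K d)) (j : Fin m) :
    weightForm d (L.col j) = 0 := by
  let := weightedGradedAlgebra K d
  by_contra hne
  rw [weightForm_eq_zero_iff] at hne
  have hmem : vectorBinomial K (L.col j) ∈ matrixIdeal K L := Ideal.subset_span ⟨j, rfl⟩
  -- If the two monomials had different degrees, the first would be a homogeneous component and so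
  -- lie in the ideal; but it takes the value 1 at `(1, …, 1)`.
  have h := hd (∑ i, d i * (L.col j i).toNat) hmem
  rw [vectorBinomial, DirectSum.decompose_sub, DirectSum.sub_apply, AddSubgroupClass.coe_sub,
    DirectSum.decompose_of_mem_same _ (prod_X_pow_mem_weightedHomogeneousSubmodule d _),
    DirectSum.decompose_of_mem_ne _ (prod_X_pow_mem_weightedHomogeneousSubmodule d _)
      (Ne.symm hne), sub_zero] at h
  simpa [map_prod] using eval_one_of_mem_matrixIdeal h

theorem eval_indicator_prod (w u : Fin s → ℕ) :
    aeval (R := K) (fun i => if w i = 0 then (1 : K) else 0) (∏ i, X i ^ u i : MvPolynomial (Fin s) K) =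
      if ∑ i, w i * u i = 0 then 1 else 0 := by
  simp only [map_prod, map_pow, aeval_X]
  split_ifs with h
  · rw [Finset.sum_eq_zero_iff] at h
    refine Finset.prod_eq_one fun i hi => ?_
    rcases Nat.mul_eq_zero.mp (h i hi) with h | h <;> simp [h]
  · obtain ⟨i, hi, hne⟩ := Finset.exists_ne_zero_of_sum_ne_zero h
    refine Finset.prod_eq_zero hi ?_
    have := mul_ne_zero_iff.mp hne
    simp [this.1, this.2]

/-- At the indicator of `{w = 0}` a monomial `t^u` is 1 or 0 according to whether `w · u` vanishes,
and the two monomials of a column have equal `w`-weight. -/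
theorem indicator_mem_zeroLocus {w : Fin s → ℕ} (hw : ∀ j, weightForm w (L.col j) = 0) {i : Fin s}
    (hi : w i ≠ 0) :
    (fun i => if w i = 0 then (1 : K) else 0) ∈
      zeroLocus K (matrixIdeal K L ⊔ Ideal.span {X i}) := by
  rw [mem_zeroLocus_iff]
  have : matrixIdeal K L ⊔ Ideal.span {X i} ≤
      RingHom.ker (aeval (R := K) (fun i => if w i = 0 then (1 : K) else 0)) := by
    rw [sup_le_iff, matrixIdeal, Ideal.span_le, Set.range_subset_iff, Ideal.span_singleton_le_iff_mem]
    constructor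
    · intro j
      rw [SetLike.mem_coe, RingHom.mem_ker, vectorBinomial, map_sub, eval_indicator_prod,
        eval_indicator_prod, (weightForm_eq_zero_iff _ _).mp (hw j), sub_self]
    · simp [RingHom.mem_ker, hi]
  exact fun p hp => this hp

theorem weight_eq_zero_of_zeroLocus
    (hV : ∀ i : Fin s, zeroLocus K (matrixIdeal K L ⊔ Ideal.span {X i}) = {0})
    {w : Fin s → ℕ} (hw : ∀ j, weightForm w (L.col j) = 0) {k : Fin s} (hk : w k = 0) (i : Fin s) :
    w i = 0 := by
  by_contra hi
  have h := indicator_mem_zeroLocus (K := K) hw hi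
  rw [hV i] at h
  have := congrFun h k
  simp [hk] at this

/-- Under the vanishing hypothesis every integral linear form killing the columns is proportional
to the weights. -/
theorem proportional_of_zeroLocus
    (hV : ∀ i : Fin s, zeroLocus K (matrixIdeal K L ⊔ Ideal.span {X i}) = {0})
    {d : Fin s → ℕ} (hd : ∀ i, 0 < d i) (hdL : ∀ j, weightForm d (L.col j) = 0)
    {v : Fin s → ℤ} (hv : ∀ j, ∑ i, v i * L i j = 0) (i k : Fin s) : v i * d k = v k * d i := by
  -- Minimizing `v_i / d_i` at `l` makes `w = d_l v - v_l d` nonnegative with a zero entry at `l`.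
  -- As `w` kills the columns, it must vanish.
  obtain ⟨l, -, hl⟩ := Finset.exists_min_image Finset.univ (fun i => (v i : ℚ) / d i) ⟨i, by simp⟩
  have hle : ∀ i, v l * d i ≤ v i * d l := by
    intro i
    have h := hl i (Finset.mem_univ _)
    have hi : (0 : ℚ) < d i := by exact_mod_cast hd i
    have hl' : (0 : ℚ) < d l := by exact_mod_cast hd l
    rw [div_le_div_iff₀ hl' hi] at h
    exact_mod_cast h
  let w : Fin s → ℕ := fun i => (v i * d l - v l * d i).toNat
  have hwv : ∀ i, (w i : ℤ) = v i * d l - v l * d i := fun i =>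
    Int.toNat_of_nonneg (sub_nonneg.mpr (hle i))
  have hw : ∀ j, weightForm w (L.col j) = 0 := by
    intro j
    have h1 := hdL j
    rw [weightForm_apply] at h1 ⊢
    have : ∀ i, (w i : ℤ) * L.col j i = d l * (v i * L i j) - v l * (d i * L.col j i) := by
      intro i
      rw [hwv, Matrix.col_apply]
      ring
    rw [Finset.sum_congr rfl fun i _ => this i, Finset.sum_sub_distrib, ← Finset.mul_sum,
      ← Finset.mul_sum, h1, hv]
    simp
  have hwl : w l = 0 := by simp [w]
  have key : ∀ i, v i * d l = v l * d i := by
    intro i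
    have := hwv i
    rw [weight_eq_zero_of_zeroLocus hV hw hwl i] at this
    push_cast at this
    linarith
  have hl0 : (d l : ℤ) ≠ 0 := by exact_mod_cast (hd l).ne'
  refine mul_right_cancel₀ hl0 ?_
  linear_combination d k * key i - d i * key k

theorem existsUnique_herzogIdeal (hs : 0 < s)
    (hV : ∀ i : Fin s, zeroLocus K (matrixIdeal K L ⊔ Ideal.span {X i}) = {0})
    {d : Fin s → ℕ} (hd : ∀ i, 0 < d i) (hdL : ∀ j, weightForm d (L.col j) = 0) :
    ∃! P : Ideal (MvPolynomial (Fin s) K), IsHerzogIdeal P ∧ matrixIdeal K L ≤ P := by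
  refine ⟨herzogIdeal K d, ⟨⟨d, hd, rfl⟩, matrixIdeal_le_herzogIdeal_iff.mpr hdL⟩, ?_⟩
  rintro _ ⟨⟨v, hv, rfl⟩, hle⟩
  have hvL := matrixIdeal_le_herzogIdeal_iff.mp hle
  let o : Fin s := ⟨0, hs⟩
  have h : (fun i => d o * v i) = fun i => v o * d i := by
    funext i
    have := proportional_of_zeroLocus hV hd hdL (v := fun i => (v i : ℤ))
      (fun j => by simpa [weightForm_apply] using hvL j) i o
    rw [mul_comm (d o)]
    exact_mod_cast this
  rw [← herzogIdeal_mul (d o) (hd o) v, h, herzogIdeal_mul _ (hv o)]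

end Weights

/-! ### Saturation and rank of the column lattice -/

section Torsion

variable {s m : ℕ} {K : Type*} [Field K] {L : Matrix (Fin s) (Fin m) ℤ}

theorem weightForm_eq_zero_of_mem_columnLattice {d : Fin s → ℕ}
    (hdL : ∀ j, weightForm d (L.col j) = 0) {a : Fin s → ℤ} (ha : a ∈ columnLattice L) :
    weightForm d a = 0 := by
  have : columnLattice L ≤ (weightForm d).toAddMonoidHom.ker := by
    rw [columnLattice, AddSubgroup.closure_le, Set.range_subset_iff]
    exact hdL
  exact this ha

/-- The kernel of the weights is the saturation of the column lattice. -/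
theorem exists_nsmul_mem_columnLattice
    (hV : ∀ i : Fin s, zeroLocus K (matrixIdeal K L ⊔ Ideal.span {X i}) = {0})
    {d : Fin s → ℕ} (hd : ∀ i, 0 < d i) (hdL : ∀ j, weightForm d (L.col j) = 0)
    {a : Fin s → ℤ} (ha : weightForm d a = 0) : ∃ N : ℕ, 0 < N ∧ N • a ∈ columnLattice L := by
  let Λ : Submodule ℤ (Fin s → ℤ) := AddSubgroup.toIntSubmodule (columnLattice L)
  let A := (Fin s → ℤ) ⧸ Λ
  let B := A ⧸ Submodule.torsion ℤ A
  let f : (Fin s → ℤ) →ₗ[ℤ] B := (Submodule.torsion ℤ A).mkQ ∘ₗ Λ.mkQ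
  -- `B` is finitely generated and torsion-free over `ℤ`, so dual functionals detect zero. Each one
  -- pulls back to a linear form killing the columns, hence proportional to `d`, hence killing `a`.
  have hf : f a = 0 := by
    rw [← Module.forall_dual_apply_eq_zero_iff ℤ]
    intro φ
    let v : Fin s → ℤ := fun i => φ (f (Pi.single i 1))
    have hφ : ∀ b : Fin s → ℤ, φ (f b) = ∑ i, v i * b i := by
      intro b
      conv_lhs => rw [← Finset.univ_sum_single b]
      rw [map_sum, map_sum]
      refine Finset.sum_congr rfl fun i _ => ?_
      have : (Pi.single i (b i) : Fin s → ℤ) = b i • Pi.single i 1 := by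
        rw [← Pi.single_smul, smul_eq_mul, mul_one]
      rw [this, map_smul, map_smul, smul_eq_mul, mul_comm]
    have hv : ∀ j, ∑ i, v i * L i j = 0 := by
      intro j
      have h1 : Λ.mkQ (L.col j) = 0 := by
        rw [Submodule.mkQ_apply, Submodule.Quotient.mk_eq_zero]
        exact AddSubgroup.subset_closure ⟨j, rfl⟩
      have h2 := hφ (L.col j)
      rw [show f (L.col j) = 0 by simp only [f, LinearMap.comp_apply, h1, map_zero], map_zero] at h2
      exact h2.symm
    rw [hφ]
    rcases isEmpty_or_nonempty (Fin s) with h | ⟨⟨o⟩⟩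
    · simp
    · have hprop := proportional_of_zeroLocus hV hd hdL hv
      have ho : (d o : ℤ) ≠ 0 := by exact_mod_cast (hd o).ne'
      refine mul_left_cancel₀ ho ?_
      rw [weightForm_apply] at ha
      rw [mul_zero, ← mul_zero (v o), ← ha, Finset.mul_sum, Finset.mul_sum]
      refine Finset.sum_congr rfl fun i _ => ?_
      linear_combination a i * hprop i o
  have h1 : Λ.mkQ a ∈ Submodule.torsion ℤ A :=
    (Submodule.Quotient.mk_eq_zero _).mp hf
  obtain ⟨⟨c, hc⟩, h2⟩ := (Submodule.mem_torsion_iff _).mp h1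
  have h3 : c • a ∈ Λ := by
    rw [← Submodule.Quotient.mk_eq_zero, Submodule.Quotient.mk_smul]
    exact h2
  have hc0 : c ≠ 0 := nonZeroDivisors.ne_zero hc
  refine ⟨c.natAbs, Int.natAbs_pos.mpr hc0, ?_⟩
  rcases Int.natAbs_eq c with h | h
  · rw [← natCast_zsmul, ← h]
    exact h3
  · have h4 : -(c • a) ∈ columnLattice L := neg_mem h3
    rwa [← neg_smul, h, neg_neg, natCast_zsmul] at h4

/-- The weights induce a nonzero map from the cokernel of `L` to `ℤ` with torsion kernel, so the
cokernel has rank one. -/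
theorem rank_eq_of_zeroLocus (hs : 0 < s)
    (hV : ∀ i : Fin s, zeroLocus K (matrixIdeal K L ⊔ Ideal.span {X i}) = {0})
    {d : Fin s → ℕ} (hd : ∀ i, 0 < d i) (hdL : ∀ j, weightForm d (L.col j) = 0) :
    L.rank = s - 1 := by
  let N := LinearMap.range L.mulVecLin
  have hN : ∀ a, a ∈ N ↔ a ∈ columnLattice L := by
    intro a
    rw [columnLattice, ← Submodule.span_int_eq_addSubgroupClosure, Submodule.mem_toAddSubgroup,
      ← Matrix.range_mulVecLin]
  let δ := N.liftQ (weightForm d) (fun a ha =>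
    weightForm_eq_zero_of_mem_columnLattice hdL ((hN a).mp ha))
  have hker : Module.finrank ℤ (LinearMap.ker δ) = 0 := by
    rw [Module.finrank_eq_zero_iff_isTorsion]
    rintro ⟨y, hy⟩
    obtain ⟨a, rfl⟩ := N.mkQ_surjective y
    obtain ⟨k, hk, hka⟩ := exists_nsmul_mem_columnLattice hV hd hdL (a := a) hy
    refine ⟨⟨(k : ℤ), mem_nonZeroDivisors_of_ne_zero (by exact_mod_cast hk.ne')⟩, ?_⟩
    ext
    change (k : ℤ) • N.mkQ a = 0
    rw [← map_smul, Submodule.mkQ_apply, Submodule.Quotient.mk_eq_zero, hN, natCast_zsmul]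
    exact hka
  have hrange : Module.finrank ℤ (LinearMap.range δ) = 1 := by
    have hle : Module.finrank ℤ (LinearMap.range δ) ≤ 1 :=
      (Submodule.finrank_le _).trans (by simp)
    have hne : Module.finrank ℤ (LinearMap.range δ) ≠ 0 := by
      rw [Ne, Submodule.finrank_eq_zero, LinearMap.range_eq_bot]
      intro h
      have h1 : δ (N.mkQ (Pi.single ⟨0, hs⟩ 1)) = d ⟨0, hs⟩ := by
        change weightForm d _ = _
        rw [weightForm_single, mul_one]
      rw [h, LinearMap.zero_apply] at h1
      exact (hd ⟨0, hs⟩).ne (by exact_mod_cast h1)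
    omega
  have h1 := Submodule.finrank_quotient_add_finrank (LinearMap.ker δ)
  rw [δ.quotKerEquivRange.finrank_eq] at h1
  have h2 := Submodule.finrank_quotient_add_finrank N
  have h3 : L.rank = Module.finrank ℤ N := rfl
  rw [Module.finrank_fin_fun] at h2
  omega

/-- The weights may be replaced by a primitive vector. -/
theorem exists_primitive_weight (hs : 0 < s) {d : Fin s → ℕ} (hd : ∀ i, 0 < d i)
    (hdL : ∀ j, weightForm d (L.col j) = 0) :
    ∃ k : Fin s → ℕ, (∀ i, 0 < k i) ∧ (∀ j, weightForm k (L.col j) = 0) ∧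
      ∃ x, weightForm k x = 1 := by
  -- The image of `d` is `gℤ`; dividing `d` by `|g|` makes the form surjective.
  obtain ⟨g, hg⟩ := (IsPrincipalIdealRing.principal (LinearMap.range (weightForm d))).principal
  have hdvd : ∀ a, g ∣ weightForm d a := by
    intro a
    have : weightForm d a ∈ LinearMap.range (weightForm d) := ⟨a, rfl⟩
    rw [hg] at this
    exact Ideal.mem_span_singleton.mp this
  have hdvd' : ∀ i, g.natAbs ∣ d i := by
    intro i
    have := hdvd (Pi.single i 1)
    rw [weightForm_single, mul_one] at this
    exact Int.natAbs_dvd_natAbs.mpr this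
  choose k hk using hdvd'
  have hg0 : g.natAbs ≠ 0 := by
    intro h
    have := hk ⟨0, hs⟩
    rw [h, zero_mul] at this
    exact (hd _).ne' this
  have hform : ∀ a, weightForm d a = g.natAbs * weightForm k a := by
    intro a
    rw [weightForm_apply, weightForm_apply, Finset.mul_sum]
    refine Finset.sum_congr rfl fun i _ => ?_
    rw [hk i]
    push_cast
    ring
  have hg0' : (g.natAbs : ℤ) ≠ 0 := by exact_mod_cast hg0
  refine ⟨k, fun i => ?_, fun j => ?_, ?_⟩
  · refine Nat.pos_of_ne_zero fun h => (hd i).ne' ?_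
    rw [hk i, h, mul_zero]
  · have := hdL j
    rw [hform] at this
    exact (mul_eq_zero.mp this).resolve_left hg0'
  · have : (g.natAbs : ℤ) ∈ LinearMap.range (weightForm d) := by
      rw [hg]
      exact Ideal.mem_span_singleton.mpr (Int.dvd_natAbs.mpr dvd_rfl)
    obtain ⟨x, hx⟩ := this
    rw [hform] at hx
    exact ⟨x, mul_left_cancel₀ hg0' (by rw [hx, mul_one])⟩

end Torsion

/-! ### Lattice ideals through monomial differences -/

section LatticeIdeal

variable {s : ℕ} {K : Type*} [Field K]

/-- The exponent vector as an integer vector. -/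
def exponentVector (u : Fin s →₀ ℕ) : Fin s → ℤ := fun i => u i

@[simp] theorem exponentVector_apply (u : Fin s →₀ ℕ) (i : Fin s) : exponentVector u i = u i := rfl

theorem exponentVector_add (u v : Fin s →₀ ℕ) :
    exponentVector (u + v) = exponentVector u + exponentVector v := by
  ext i
  simp

/-- Positive part of an integer vector, as an exponent. -/
noncomputable def posExponent (a : Fin s → ℤ) : Fin s →₀ ℕ := Finsupp.equivFunOnFinite.symm fun i => (a i).toNat

@[simp] theorem posExponent_apply (a : Fin s → ℤ) (i : Fin s) : posExponent a i = (a i).toNat := rfl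

theorem exponentVector_posExponent_sub (a : Fin s → ℤ) :
    exponentVector (posExponent a) - exponentVector (posExponent (-a)) = a := by
  ext i
  simp

theorem prod_X_pow_eq_monomial' (u : Fin s →₀ ℕ) :
    (∏ i, X i ^ u i : MvPolynomial (Fin s) K) = monomial u 1 := by
  rw [monomial_eq, C_1, one_mul, Finsupp.prod_fintype _ _ fun i => pow_zero _]

theorem vectorBinomial_eq_monomial_sub (a : Fin s → ℤ) :
    vectorBinomial K a = monomial (posExponent a) 1 - monomial (posExponent (-a)) 1 := by
  rw [← prod_X_pow_eq_monomial', ← prod_X_pow_eq_monomial']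
  rfl

theorem exists_monomial_sub_eq_mul_vectorBinomial (u v : Fin s →₀ ℕ) :
    ∃ w : Fin s →₀ ℕ, (monomial u 1 - monomial v 1 : MvPolynomial (Fin s) K) =
      monomial w 1 * vectorBinomial K (exponentVector u - exponentVector v) := by
  refine ⟨u ⊓ v, ?_⟩
  rw [vectorBinomial_eq_monomial_sub, mul_sub, monomial_mul, monomial_mul, mul_one]
  congr 2
  · congr 1
    ext i
    simp only [Finsupp.coe_add, Pi.add_apply, Finsupp.inf_apply, posExponent_apply, Pi.sub_apply,
      exponentVector_apply]
    omega
  · congr 1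
    ext i
    simp only [Finsupp.coe_add, Pi.add_apply, Finsupp.inf_apply, posExponent_apply, Pi.sub_apply,
      Pi.neg_apply, exponentVector_apply]
    omega

theorem monomial_sub_mem_latticeIdeal {Λ : AddSubgroup (Fin s → ℤ)} {u v : Fin s →₀ ℕ}
    (h : exponentVector u - exponentVector v ∈ Λ) :
    (monomial u 1 - monomial v 1 : MvPolynomial (Fin s) K) ∈ latticeIdeal K Λ := by
  obtain ⟨w, hw⟩ := exists_monomial_sub_eq_mul_vectorBinomial (K := K) u v
  rw [hw]
  exact Ideal.mul_mem_left _ _ (Ideal.subset_span ⟨_, h, rfl⟩)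

/-- Differences of monomials telescope under addition of exponents. The exponents `u`, `v` obtained
may share a common factor, which only the saturation removes. -/
theorem exists_monomial_sub_mem_matrixIdeal {m : ℕ} {L : Matrix (Fin s) (Fin m) ℤ}
    {a : Fin s → ℤ} (ha : a ∈ columnLattice L) :
    ∃ u v : Fin s →₀ ℕ, exponentVector u - exponentVector v = a ∧
      (monomial u 1 - monomial v 1 : MvPolynomial (Fin s) K) ∈ matrixIdeal K L := by
  induction ha using AddSubgroup.closure_induction with
  | mem a ha =>
    obtain ⟨j, rfl⟩ := ha
    refine ⟨_, _, exponentVector_posExponent_sub _, ?_⟩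
    rw [← vectorBinomial_eq_monomial_sub]
    exact Ideal.subset_span ⟨j, rfl⟩
  | zero => exact ⟨0, 0, sub_self _, by simp⟩
  | add a b _ _ ha hb =>
    obtain ⟨u, v, rfl, huv⟩ := ha
    obtain ⟨u', v', rfl, huv'⟩ := hb
    refine ⟨u + u', v + v', by rw [exponentVector_add, exponentVector_add]; abel, ?_⟩
    have e : (monomial (u + u') 1 - monomial (v + v') 1 : MvPolynomial (Fin s) K) =
        monomial u' 1 * (monomial u 1 - monomial v 1) +
          monomial v 1 * (monomial u' 1 - monomial v' 1) := by
      simp only [mul_sub, monomial_mul, mul_one, add_comm u' u, add_comm u' v]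
      ring
    rw [e]
    exact Ideal.add_mem _ (Ideal.mul_mem_left _ _ huv) (Ideal.mul_mem_left _ _ huv')
  | neg a _ ha =>
    obtain ⟨u, v, rfl, huv⟩ := ha
    exact ⟨v, u, by abel, by rw [← neg_sub]; exact neg_mem huv⟩

/-- The extra 1 in the exponent supplies the positive power required by `idealSaturation`. -/
theorem monomial_dvd_prod_X_pow (w : Fin s →₀ ℕ) :
    (monomial w 1 : MvPolynomial (Fin s) K) ∣ (∏ i, X i) ^ (∑ i, w i + 1) := by
  rw [← prod_X_pow_eq_monomial', ← Finset.prod_pow]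
  refine Finset.prod_dvd_prod_of_dvd _ _ fun i hi => pow_dvd_pow _ ?_
  exact (Finset.single_le_sum (fun j _ => Nat.zero_le (w j)) hi).trans (Nat.le_succ _)

theorem matrixIdeal_le_latticeIdeal {m : ℕ} (L : Matrix (Fin s) (Fin m) ℤ) :
    matrixIdeal K L ≤ latticeIdeal K (columnLattice L) := by
  refine Ideal.span_le.mpr ?_
  rintro _ ⟨j, rfl⟩
  exact Ideal.subset_span ⟨_, AddSubgroup.subset_closure ⟨j, rfl⟩, rfl⟩

theorem latticeIdeal_le_saturation {m : ℕ} (L : Matrix (Fin s) (Fin m) ℤ) :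
    latticeIdeal K (columnLattice L) ≤ idealSaturation (matrixIdeal K L) (∏ i, X i) := by
  refine Ideal.span_le.mpr ?_
  rintro _ ⟨a, ha, rfl⟩
  obtain ⟨u, v, rfl, huv⟩ := exists_monomial_sub_mem_matrixIdeal (K := K) ha
  obtain ⟨w, hw⟩ := exists_monomial_sub_eq_mul_vectorBinomial (K := K) u v
  obtain ⟨c, hc⟩ := monomial_dvd_prod_X_pow (K := K) w
  refine ⟨_, Nat.le_add_left 1 (∑ i, w i), ?_⟩
  rw [hc, ← mul_assoc, mul_comm _ (monomial w 1), ← hw]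
  exact Ideal.mul_mem_right _ _ huv

end LatticeIdeal

/-! ### Weighted evaluation maps into a polynomial ring -/

section GradedMap

variable {s : ℕ} {K A : Type*} [Field K] [CommRing A] [Algebra K A]

/-- The algebra map `K[t_1, …, t_s] → A[x]` sending `t_i` to `y_i x^{k_i}`. -/
noncomputable def weightedAeval (k : Fin s → ℕ) (y : Fin s → A) : MvPolynomial (Fin s) K →ₐ[K] Polynomial A :=
  aeval fun i => Polynomial.monomial (k i) (y i)

@[simp] theorem weightedAeval_X (k : Fin s → ℕ) (y : Fin s → A) (i : Fin s) :
    weightedAeval (K := K) k y (X i) = Polynomial.monomial (k i) (y i) := by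
  simp [weightedAeval]

theorem Polynomial.prod_monomial {ι : Type*} (t : Finset ι) (k : ι → ℕ) (y : ι → A) :
    ∏ i ∈ t, Polynomial.monomial (k i) (y i) = Polynomial.monomial (∑ i ∈ t, k i) (∏ i ∈ t, y i) := by
  classical
  induction t using Finset.induction_on with
  | empty => simp
  | insert i t hi ih =>
    rw [Finset.prod_insert hi, ih, Polynomial.monomial_mul_monomial, Finset.sum_insert hi,
      Finset.prod_insert hi]

theorem weightedAeval_monomial (k : Fin s → ℕ) (y : Fin s → A) (u : Fin s →₀ ℕ) (c : K) :
    weightedAeval k y (monomial u c) =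
      Polynomial.monomial (∑ i, u i * k i) (c • ∏ i, y i ^ u i) := by
  have : monomial u c = c • (∏ i, X i ^ u i : MvPolynomial (Fin s) K) := by
    rw [prod_X_pow_eq_monomial', smul_monomial, smul_eq_mul, mul_one]
  rw [this, map_smul, map_prod]
  simp only [map_pow, weightedAeval_X, Polynomial.monomial_pow]
  rw [Polynomial.prod_monomial, Polynomial.smul_monomial]
  simp only [mul_comm]

/-- The leading coefficient of `f(c x^k)` is that of `f` times a power of `c`, a unit. This works
for any `A`, reduced or not. -/
theorem aeval_monomial_mem_nonZeroDivisors {k : ℕ} (hk : 0 < k) {c : A} (hc : IsUnit c)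
    {f : Polynomial K} (hf : f ≠ 0) :
    Polynomial.aeval (Polynomial.monomial k c) f ∈ nonZeroDivisors (Polynomial A) := by
  nontriviality A
  have hsum : Polynomial.aeval (Polynomial.monomial k c) f =
      ∑ n ∈ Finset.range (f.natDegree + 1), Polynomial.monomial (k * n) (f.coeff n • c ^ n) := by
    rw [Polynomial.aeval_eq_sum_range]
    refine Finset.sum_congr rfl fun n _ => ?_
    rw [Polynomial.monomial_pow, Polynomial.smul_monomial]
  have hdeg : (Polynomial.aeval (Polynomial.monomial k c) f).natDegree ≤ k * f.natDegree := by
    rw [hsum]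
    refine Polynomial.natDegree_sum_le_of_forall_le _ _ fun n hn => ?_
    refine (Polynomial.natDegree_monomial_le _).trans (Nat.mul_le_mul_left _ ?_)
    exact Nat.lt_succ_iff.mp (Finset.mem_range.mp hn)
  have hcoeff : (Polynomial.aeval (Polynomial.monomial k c) f).coeff (k * f.natDegree) =
      f.leadingCoeff • c ^ f.natDegree := by
    rw [hsum, Polynomial.finsetSum_coeff, Finset.sum_eq_single f.natDegree]
    · rw [Polynomial.coeff_monomial, if_pos rfl]
      rfl
    · intro n _ hn
      rw [Polynomial.coeff_monomial, if_neg]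
      exact fun h => hn (Nat.eq_of_mul_eq_mul_left hk h)
    · simp
  have hunit : IsUnit (f.leadingCoeff • c ^ f.natDegree) := by
    rw [Algebra.smul_def]
    exact ((IsUnit.mk0 _ (Polynomial.leadingCoeff_ne_zero.mpr hf)).map (algebraMap K A)).mul
      (hc.pow _)
  refine Polynomial.mem_nonZeroDivisors_of_leadingCoeff ?_
  have hnat : (Polynomial.aeval (Polynomial.monomial k c) f).natDegree = k * f.natDegree :=
    le_antisymm hdeg (Polynomial.le_natDegree_of_ne_zero (hcoeff ▸ hunit.ne_zero))
  rw [Polynomial.leadingCoeff, hnat, hcoeff]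
  exact hunit.mem_nonZeroDivisors

theorem weightedAeval_aeval_X (k : Fin s → ℕ) (y : Fin s → A) (i : Fin s) (f : Polynomial K) :
    weightedAeval (K := K) k y (Polynomial.aeval (X i) f) =
      Polynomial.aeval (Polynomial.monomial (k i) (y i)) f := by
  rw [← Polynomial.aeval_algHom_apply, weightedAeval_X]

end GradedMap

/-! ### Evaluation along a character of `ℤ^s` -/

section LatticeAeval

variable {s : ℕ} {K A : Type*} [Field K] [CommRing A] [Algebra K A]

theorem sum_mul_eq_weightForm (k : Fin s → ℕ) (u : Fin s →₀ ℕ) :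
    ((∑ i, u i * k i : ℕ) : ℤ) = weightForm k (exponentVector u) := by
  rw [weightForm_apply]
  push_cast
  exact Finset.sum_congr rfl fun i _ => mul_comm _ _

theorem sum_exponentVector {B : Type*} [AddCommGroup B] (φ : (Fin s → ℤ) →+ B) (u : Fin s →₀ ℕ) :
    φ (exponentVector u) = ∑ i, u i • φ (Pi.single i 1) := by
  rw [← Finset.univ_sum_single (exponentVector u), map_sum]
  refine Finset.sum_congr rfl fun i _ => ?_
  rw [← map_nsmul, ← Pi.single_smul]
  simp

/-- The algebra map sending `t^u` to `Y(u) x^{k · u}`, for a character `Y` of `ℤ^s` and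
weights `k`. -/
noncomputable def latticeAeval (k : Fin s → ℕ) (Y : Multiplicative (Fin s → ℤ) →* A) :
    MvPolynomial (Fin s) K →ₐ[K] Polynomial A :=
  weightedAeval k fun i => Y (Multiplicative.ofAdd (Pi.single i 1))

theorem isUnit_character (Y : Multiplicative (Fin s → ℤ) →* A) (a : Multiplicative (Fin s → ℤ)) :
    IsUnit (Y a) := (Group.isUnit a).map Y

theorem prod_character_pow (Y : Multiplicative (Fin s → ℤ) →* A) (u : Fin s →₀ ℕ) :
    ∏ i, Y (Multiplicative.ofAdd (Pi.single i 1)) ^ u i =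
      Y (Multiplicative.ofAdd (exponentVector u)) := by
  rw [← AddMonoidHom.id_apply _ (exponentVector u), sum_exponentVector, ofAdd_sum, map_prod]
  simp only [AddMonoidHom.id_apply, ofAdd_nsmul, map_pow]

theorem latticeAeval_monomial (k : Fin s → ℕ) (Y : Multiplicative (Fin s → ℤ) →* A)
    (u : Fin s →₀ ℕ) (c : K) :
    latticeAeval k Y (monomial u c) =
      Polynomial.monomial (∑ i, u i * k i) (c • Y (Multiplicative.ofAdd (exponentVector u))) := by
  rw [latticeAeval, weightedAeval_monomial, prod_character_pow]

theorem latticeAeval_aeval_X_mem_nonZeroDivisors {k : Fin s → ℕ}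
    (Y : Multiplicative (Fin s → ℤ) →* A) {i : Fin s} (hk : 0 < k i) {f : Polynomial K}
    (hf : f ≠ 0) :
    latticeAeval k Y (Polynomial.aeval (X i : MvPolynomial (Fin s) K) f) ∈ nonZeroDivisors (Polynomial A) := by
  rw [latticeAeval, weightedAeval_aeval_X]
  exact aeval_monomial_mem_nonZeroDivisors hk (isUnit_character Y _) hf

theorem latticeAeval_X_mem_nonZeroDivisors {k : Fin s → ℕ}
    (Y : Multiplicative (Fin s → ℤ) →* A) {i : Fin s} (hk : 0 < k i) :
    latticeAeval (K := K) k Y (X i) ∈ nonZeroDivisors (Polynomial A) := by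
  simpa using latticeAeval_aeval_X_mem_nonZeroDivisors (K := K) Y hk Polynomial.X_ne_zero

theorem latticeIdeal_le_ker_latticeAeval {Λ : AddSubgroup (Fin s → ℤ)} {k : Fin s → ℕ}
    {Y : Multiplicative (Fin s → ℤ) →* A} (hk : ∀ a ∈ Λ, weightForm k a = 0)
    (hY : ∀ a ∈ Λ, Y (Multiplicative.ofAdd a) = 1) :
    latticeIdeal K Λ ≤ RingHom.ker (latticeAeval (K := K) k Y) := by
  refine Ideal.span_le.mpr ?_
  rintro _ ⟨a, ha, rfl⟩
  have ha' := exponentVector_posExponent_sub a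
  rw [SetLike.mem_coe, RingHom.mem_ker, vectorBinomial_eq_monomial_sub, map_sub,
    latticeAeval_monomial, latticeAeval_monomial, sub_eq_zero]
  have h1 : ∑ i, posExponent a i * k i = ∑ i, posExponent (-a) i * k i := by
    have := hk a ha
    rw [← ha', map_sub, sub_eq_zero, ← sum_mul_eq_weightForm, ← sum_mul_eq_weightForm] at this
    exact_mod_cast this
  have h2 : Y (Multiplicative.ofAdd (exponentVector (posExponent a))) =
      Y (Multiplicative.ofAdd (exponentVector (posExponent (-a)))) := by
    conv_lhs => rw [← sub_add_cancel (exponentVector (posExponent a))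
      (exponentVector (posExponent (-a))), ha', ofAdd_add, map_mul, hY a ha, one_mul]
  rw [h1, h2]

end LatticeAeval

/-! ### The lattice ideal as a kernel into a group algebra -/

section GroupAlgebra

variable {s : ℕ} {K Γ : Type*} [Field K] [AddCommGroup Γ]

/-- The character of `ℤ^s` with values in the group algebra of `Γ` induced by `π : ℤ^s → Γ`. -/
noncomputable def groupCharacter (K : Type*) [Field K] (π : (Fin s → ℤ) →+ Γ) :
    Multiplicative (Fin s → ℤ) →* AddMonoidAlgebra K Γ :=
  (AddMonoidAlgebra.of K Γ).comp π.toMultiplicative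

theorem groupCharacter_apply (π : (Fin s → ℤ) →+ Γ) (a : Fin s → ℤ) :
    groupCharacter K π (Multiplicative.ofAdd a) = AddMonoidAlgebra.single (π a) 1 := rfl

/-- A `K`-linear map `ψ` back to the quotient by the lattice ideal sends `[g] x^n` to the class of
any monomial of weight `n` and class `g`. All choices agree modulo the lattice ideal, so `ψ` after
the evaluation is the quotient map. -/
theorem ker_latticeAeval_groupCharacter_le {Λ : AddSubgroup (Fin s → ℤ)} {k : Fin s → ℕ}
    {π : (Fin s → ℤ) →+ Γ} (hΛ : ∀ a, weightForm k a = 0 → π a = 0 → a ∈ Λ) :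
    RingHom.ker (latticeAeval (K := K) k (groupCharacter K π)) ≤ latticeIdeal K Λ := by
  classical
  let J := latticeIdeal K Λ
  let rep : ℕ → Γ → MvPolynomial (Fin s) K ⧸ J := fun n g =>
    if h : ∃ u : Fin s →₀ ℕ, ∑ i, u i * k i = n ∧ π (exponentVector u) = g then
      Ideal.Quotient.mk J (monomial h.choose 1) else 0
  have hrep : ∀ u : Fin s →₀ ℕ, rep (∑ i, u i * k i) (π (exponentVector u)) =
      Ideal.Quotient.mk J (monomial u 1) := by
    intro u
    have h : ∃ v : Fin s →₀ ℕ, ∑ i, v i * k i = ∑ i, u i * k i ∧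
        π (exponentVector v) = π (exponentVector u) := ⟨u, rfl, rfl⟩
    simp only [rep]
    rw [dif_pos h, Ideal.Quotient.eq]
    refine monomial_sub_mem_latticeIdeal (hΛ _ ?_ ?_)
    · rw [map_sub, sub_eq_zero, ← sum_mul_eq_weightForm, ← sum_mul_eq_weightForm]
      exact_mod_cast h.choose_spec.1
    · rw [map_sub, sub_eq_zero, h.choose_spec.2]
  let ψ : Polynomial (AddMonoidAlgebra K Γ) →ₗ[K] MvPolynomial (Fin s) K ⧸ J :=
    Polynomial.lsum fun n =>
      (Finsupp.linearCombination K (rep n)) ∘ₗ (AddMonoidAlgebra.coeffLinearEquiv K).toLinearMap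
  have hψ : ψ ∘ₗ (latticeAeval (K := K) k (groupCharacter K π)).toLinearMap =
      (Ideal.Quotient.mkₐ K J).toLinearMap := by
    refine MvPolynomial.linearMap_ext fun u => LinearMap.ext_ring ?_
    simp only [LinearMap.comp_apply, AlgHom.toLinearMap_apply, latticeAeval_monomial,
      groupCharacter_apply, one_smul, ψ, Polynomial.lsum_apply]
    rw [Polynomial.sum_monomial_index]
    · simp [hrep]
    · simp
  intro f hf
  rw [RingHom.mem_ker] at hf
  have := LinearMap.congr_fun hψ f
  rw [LinearMap.comp_apply, AlgHom.toLinearMap_apply, hf, map_zero] at this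
  exact Ideal.Quotient.eq_zero_iff_mem.mp this.symm

variable {Λ : AddSubgroup (Fin s → ℤ)} {k : Fin s → ℕ} {π : (Fin s → ℤ) →+ Γ}

theorem latticeIdeal_eq_ker (hΛ : ∀ a, a ∈ Λ ↔ weightForm k a = 0 ∧ π a = 0) :
    latticeIdeal K Λ = RingHom.ker (latticeAeval (K := K) k (groupCharacter K π)) := by
  refine le_antisymm (latticeIdeal_le_ker_latticeAeval (fun a ha => ((hΛ a).mp ha).1)
    fun a ha => ?_) (ker_latticeAeval_groupCharacter_le fun a h h' => (hΛ a).mpr ⟨h, h'⟩)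
  rw [groupCharacter_apply, ((hΛ a).mp ha).2]
  rfl

theorem mem_latticeIdeal_of_mul_mem (hΛ : ∀ a, a ∈ Λ ↔ weightForm k a = 0 ∧ π a = 0)
    {f g : MvPolynomial (Fin s) K} (h : f * g ∈ latticeIdeal K Λ)
    (hg : latticeAeval k (groupCharacter K π) g ∈ nonZeroDivisors _) : f ∈ latticeIdeal K Λ := by
  rw [latticeIdeal_eq_ker hΛ, RingHom.mem_ker] at h ⊢
  rw [map_mul] at h
  exact (mul_right_mem_nonZeroDivisors_eq_zero_iff hg).mp h

theorem latticeIdeal_eq_idealSaturation {m : ℕ} {L : Matrix (Fin s) (Fin m) ℤ}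
    (hk : ∀ i, 0 < k i) (hΛ : ∀ a, a ∈ columnLattice L ↔ weightForm k a = 0 ∧ π a = 0) :
    latticeIdeal K (columnLattice L) = idealSaturation (matrixIdeal K L) (∏ i, X i) := by
  refine le_antisymm (latticeIdeal_le_saturation L) ?_
  rintro f ⟨n, -, hf⟩
  refine mem_latticeIdeal_of_mul_mem hΛ (matrixIdeal_le_latticeIdeal L hf) ?_
  rw [map_pow, map_prod]
  exact pow_mem (prod_mem fun i _ => latticeAeval_X_mem_nonZeroDivisors _ (hk i)) n

/-- Nonzero polynomials in one variable do not lie in associated primes of the lattice ideal. -/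
theorem eq_zero_of_aeval_X_mem_associatedPrime (hk : ∀ i, 0 < k i)
    (hΛ : ∀ a, a ∈ Λ ↔ weightForm k a = 0 ∧ π a = 0) {p : Ideal (MvPolynomial (Fin s) K)}
    (hp : p ∈ associatedPrimes _ (MvPolynomial (Fin s) K ⧸ latticeIdeal K Λ)) (i : Fin s)
    {f : Polynomial K} (hf : Polynomial.aeval (X i) f ∈ p) : f = 0 := by
  by_contra hne
  rw [mem_associatedPrimes_quotient_iff] at hp
  obtain ⟨hprime, x, rfl⟩ := hp
  obtain ⟨n, hn⟩ := hf
  rw [Submodule.mem_colon_singleton, smul_eq_mul, mul_comm] at hn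
  have hx : x ∈ latticeIdeal K Λ := by
    refine mem_latticeIdeal_of_mul_mem hΛ hn ?_
    rw [map_pow]
    exact pow_mem (latticeAeval_aeval_X_mem_nonZeroDivisors _ (hk i) hne) n
  refine hprime.ne_top ?_
  rw [(Submodule.colon_eq_top_iff_subset _).mpr (Set.singleton_subset_iff.mpr hx), Ideal.radical_top]

end GroupAlgebra

/-! ### Counting the minimal primes -/

section Counting

/-- By the Chinese remainder theorem `A` surjects onto the product of its residue fields, each of
dimension at least one. -/
theorem card_primeSpectrum_le_finrank (K A : Type*) [Field K] [CommRing A] [Algebra K A]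
    [Module.Finite K A] : Finite (PrimeSpectrum A) ∧
      Nat.card (PrimeSpectrum A) ≤ Module.finrank K A := by
  have : IsArtinianRing A := IsArtinianRing.of_finite K A
  have hfin : Finite (PrimeSpectrum A) := inferInstance
  refine ⟨hfin, ?_⟩
  let := Fintype.ofFinite (PrimeSpectrum A)
  let F : A →ₗ[K] ((p : PrimeSpectrum A) → A ⧸ p.asIdeal) :=
    LinearMap.pi fun p => (Ideal.Quotient.mkₐ K p.asIdeal).toLinearMap
  have hsurj : Function.Surjective F := by
    have hco : Pairwise (Function.onFun IsCoprime fun p : PrimeSpectrum A => p.asIdeal) := by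
      intro p q hpq
      have := IsArtinianRing.isMaximal_of_isPrime p.asIdeal
      have := IsArtinianRing.isMaximal_of_isPrime q.asIdeal
      exact Ideal.isCoprime_of_isMaximal fun h => hpq (PrimeSpectrum.ext h)
    intro y
    obtain ⟨z, hz⟩ := Ideal.quotientInfToPiQuotient_surj hco y
    obtain ⟨x, rfl⟩ := Ideal.Quotient.mk_surjective z
    exact ⟨x, by rw [← hz]; rfl⟩
  refine le_trans ?_ (LinearMap.finrank_le_finrank_of_surjective hsurj)
  rw [Module.finrank_pi_fintype, Nat.card_eq_fintype_card, Fintype.card_eq_sum_ones]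
  exact Finset.sum_le_sum fun p _ => Module.finrank_pos

variable {s : ℕ} {K Γ : Type*} [Field K] [AddCommGroup Γ] {Λ : AddSubgroup (Fin s → ℤ)}
  {k : Fin s → ℕ} {π : (Fin s → ℤ) →+ Γ}

/-- The character of `ℤ^s` with values in a quotient of the group algebra of `Γ`. -/
noncomputable def quotientCharacter (K : Type*) [Field K] (π : (Fin s → ℤ) →+ Γ)
    (M : Ideal (AddMonoidAlgebra K Γ)) :
    Multiplicative (Fin s → ℤ) →* AddMonoidAlgebra K Γ ⧸ M :=
  (Ideal.Quotient.mk M).toMonoidHom.comp (groupCharacter K π)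

theorem quotientCharacter_apply (π : (Fin s → ℤ) →+ Γ) (M : Ideal (AddMonoidAlgebra K Γ))
    (a : Fin s → ℤ) : quotientCharacter K π M (Multiplicative.ofAdd a) =
      Ideal.Quotient.mk M (AddMonoidAlgebra.single (π a) 1) := rfl

/-- The ideal of `K[t_1, …, t_s]` given by an ideal `M` of the group algebra of `Γ`. -/
noncomputable def idealOfGroupAlgebra (K : Type*) [Field K] (k : Fin s → ℕ)
    (π : (Fin s → ℤ) →+ Γ) (M : Ideal (AddMonoidAlgebra K Γ)) : Ideal (MvPolynomial (Fin s) K) :=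
  RingHom.ker (latticeAeval (K := K) k (quotientCharacter K π M))

theorem isPrime_idealOfGroupAlgebra (M : Ideal (AddMonoidAlgebra K Γ)) [M.IsPrime] :
    (idealOfGroupAlgebra K k π M).IsPrime :=
  RingHom.ker_isPrime _

theorem latticeIdeal_le_idealOfGroupAlgebra (hk : ∀ a ∈ Λ, weightForm k a = 0)
    (hπ : ∀ a ∈ Λ, π a = 0) (M : Ideal (AddMonoidAlgebra K Γ)) :
    latticeIdeal K Λ ≤ idealOfGroupAlgebra K k π M := by
  refine latticeIdeal_le_ker_latticeAeval hk fun a ha => ?_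
  rw [quotientCharacter_apply, hπ a ha]
  exact map_one (Ideal.Quotient.mk M)

/-- A point of the lattice ideal in a field with nonzero coordinates specializes a prime
coming from the group algebra. -/
theorem exists_idealOfGroupAlgebra_le_ker {F : Type*} [Field F] [Algebra K F]
    -- Here `q` is the exponential characteristic: 1 in characteristic zero, otherwise `p`.
    (ι : MvPolynomial (Fin s) K →ₐ[K] F) (hX : ∀ i, ι (X i) ≠ 0)
    (hι : latticeIdeal K Λ ≤ RingHom.ker ι) (q : ℕ) [ExpChar K q]
    (hsec : ∀ g, ∃ a, π a = g ∧ weightForm k a = 0) {x : Fin s → ℤ} (hx : weightForm k x = 1)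
    (hxπ : π x = 0) (hΛ : ∀ a, weightForm k a = 0 → π a = 0 → ∃ r : ℕ, q ^ r • a ∈ Λ) :
    ∃ M : Ideal (AddMonoidAlgebra K Γ), M.IsPrime ∧ idealOfGroupAlgebra K k π M ≤ RingHom.ker ι := by
  have : ExpChar F q := expChar_of_injective_algebraMap (algebraMap K F).injective q
  let U : (Fin s → ℤ) →+ Additive Fˣ :=
    ∑ i, (zmultiplesHom _ (Additive.ofMul (Units.mk0 _ (hX i)))).comp
      (Pi.evalAddMonoidHom (fun _ : Fin s => ℤ) i)
  have hUsingle : ∀ i, U (Pi.single i 1) = Additive.ofMul (Units.mk0 _ (hX i)) := by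
    intro i
    simp only [U, AddMonoidHom.finsetSum_apply, AddMonoidHom.comp_apply, Pi.evalAddMonoidHom_apply,
      zmultiplesHom_apply]
    rw [Finset.sum_eq_single i]
    · simp
    · intro j _ hj
      simp [Pi.single_eq_of_ne hj]
    · simp
  have hmon : ∀ u : Fin s →₀ ℕ, ι (monomial u 1) = ((U (exponentVector u)).toMul : Fˣ) := by
    intro u
    rw [sum_exponentVector, ← prod_X_pow_eq_monomial', map_prod, toMul_sum, Units.coe_prod]
    refine Finset.prod_congr rfl fun i _ => ?_
    rw [hUsingle, map_pow, toMul_nsmul, toMul_ofMul, Units.val_pow_eq_pow_val, Units.val_mk0]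
  have hUΛ : ∀ a ∈ Λ, U a = 0 := by
    intro a ha
    have h := hι (Ideal.subset_span ⟨a, ha, rfl⟩ : vectorBinomial K a ∈ latticeIdeal K Λ)
    rw [RingHom.mem_ker, vectorBinomial_eq_monomial_sub, map_sub, hmon, hmon, sub_eq_zero] at h
    rw [← exponentVector_posExponent_sub a, map_sub, sub_eq_zero]
    exact Additive.toMul.injective (Units.ext h)
  -- `U(a)` becomes 1 after raising to the power `q^r`, and the iterated Frobenius of the field `F`
  -- is injective.
  have hU0 : ∀ a, weightForm k a = 0 → π a = 0 → U a = 0 := by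
    intro a h1 h2
    obtain ⟨r, hr⟩ := hΛ a h1 h2
    have h3 := hUΛ _ hr
    rw [map_nsmul] at h3
    refine Additive.toMul.injective (Units.ext ?_)
    refine iterateFrobenius_inj F q r ?_
    rw [iterateFrobenius_def, iterateFrobenius_def, ← Units.val_pow_eq_pow_val, ← toMul_nsmul, h3]
    simp
  choose sec hsecπ hseck using hsec
  -- The section `sec` need not be additive, but its defect has weight zero and trivial class, so
  -- `U` does not see it.
  let χ : Γ →+ Additive Fˣ := AddMonoidHom.mk' (fun g => U (sec g)) fun g h => by
    rw [← map_add, ← sub_eq_zero, ← map_sub]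
    refine hU0 _ ?_ ?_
    · simp only [map_sub, map_add, hseck, add_zero, sub_zero]
    · simp only [map_sub, map_add, hsecπ, sub_self]
  have hχ : ∀ a, U a = χ (π a) + weightForm k a • U x := by
    intro a
    change U a = U (sec (π a)) + _
    rw [← sub_eq_zero, ← map_zsmul, ← map_add, ← map_sub]
    refine hU0 _ ?_ ?_
    · rw [map_sub, map_add, map_zsmul, hseck, hx, zero_add, smul_eq_mul, mul_one, sub_self]
    · rw [map_sub, map_add, map_zsmul, hsecπ, hxπ, smul_zero, add_zero, sub_self]
  let φ : AddMonoidAlgebra K Γ →ₐ[K] F :=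
    AddMonoidAlgebra.lift K F Γ ((Units.coeHom F).comp (AddMonoidHom.toMultiplicativeLeft χ))
  have hφ : ∀ g, φ (AddMonoidAlgebra.single g 1) = ((χ g).toMul : Fˣ) := by
    intro g
    simp only [φ, AddMonoidAlgebra.lift_single, one_smul]
    rfl
  refine ⟨RingHom.ker φ, RingHom.ker_isPrime φ, ?_⟩
  let z : F := ((U x).toMul : Fˣ)
  -- By `hχ`, `ι` factors through the evaluation map via `x ↦ U(x)` and `φ` on coefficients.
  let E : Polynomial (AddMonoidAlgebra K Γ ⧸ RingHom.ker φ) →+* F :=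
    Polynomial.eval₂RingHom (Ideal.kerLiftAlg φ).toRingHom z
  have hE : E.comp (latticeAeval (K := K) k (quotientCharacter K π (RingHom.ker φ))).toRingHom = ι.toRingHom := by
    refine MvPolynomial.ringHom_ext (fun c => ?_) fun i => ?_
    · simp only [E, RingHom.comp_apply, AlgHom.toRingHom_eq_coe, RingHom.coe_coe]
      rw [← MvPolynomial.algebraMap_eq, AlgHom.commutes, AlgHom.commutes,
        IsScalarTower.algebraMap_apply K (AddMonoidAlgebra K Γ ⧸ RingHom.ker φ) (Polynomial _),
        Polynomial.algebraMap_eq, Polynomial.coe_eval₂RingHom, Polynomial.eval₂_C, RingHom.coe_coe,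
        AlgHom.commutes]
    · simp only [E, RingHom.comp_apply, AlgHom.toRingHom_eq_coe, RingHom.coe_coe, latticeAeval,
        weightedAeval_X, Polynomial.coe_eval₂RingHom, Polynomial.eval₂_monomial,
        quotientCharacter_apply]
      have h1 := hχ (Pi.single i 1)
      rw [hUsingle, weightForm_single, mul_one] at h1
      have h2 := congrArg (fun y : Additive Fˣ => ((y.toMul : Fˣ) : F)) h1
      simp only [toMul_ofMul, Units.val_mk0, toMul_add, Units.val_mul, natCast_zsmul, toMul_nsmul,
        Units.val_pow_eq_pow_val] at h2
      rw [h2, ← hφ]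
      rfl
  intro f hf
  have h := RingHom.congr_fun hE f
  rw [RingHom.comp_apply] at h
  rw [RingHom.mem_ker]
  refine h.symm.trans ?_
  have hf' : (latticeAeval (K := K) k (quotientCharacter K π (RingHom.ker φ))) f = 0 := hf
  change E ((latticeAeval (K := K) k (quotientCharacter K π (RingHom.ker φ))) f) = 0
  rw [hf', map_zero]

/-- A prime in `P` is the kernel of a point in the fraction field of its quotient, so it contains a
prime coming from `K[Γ]`; minimality turns the inclusion into equality. -/
theorem ncard_le_card_of_minimal [Finite Γ] (q : ℕ) [ExpChar K q]
    (hΛk : ∀ a ∈ Λ, weightForm k a = 0) (hΛπ : ∀ a ∈ Λ, π a = 0)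
    (hsec : ∀ g, ∃ a, π a = g ∧ weightForm k a = 0) {x : Fin s → ℤ} (hx : weightForm k x = 1)
    (hxπ : π x = 0) (hΛ : ∀ a, weightForm k a = 0 → π a = 0 → ∃ r : ℕ, q ^ r • a ∈ Λ)
    (P : Set (Ideal (MvPolynomial (Fin s) K)))
    (hP : ∀ p ∈ P, p ∈ (latticeIdeal K Λ).minimalPrimes ∧ ∀ i, X i ∉ p) :
    P.ncard ≤ Nat.card Γ := by
  obtain ⟨hfin, hcard⟩ := card_primeSpectrum_le_finrank K (AddMonoidAlgebra K Γ)
  have hrank : Module.finrank K (AddMonoidAlgebra K Γ) = Nat.card Γ := by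
    have := Fintype.ofFinite Γ
    rw [(AddMonoidAlgebra.coeffLinearEquiv K).finrank_eq, Module.finrank_finsupp_self,
      Nat.card_eq_fintype_card]
  have hsub : P ⊆ (fun M : PrimeSpectrum (AddMonoidAlgebra K Γ) =>
      idealOfGroupAlgebra K k π M.asIdeal) '' Set.univ := by
    intro p hp
    obtain ⟨hmin, hX⟩ := hP p hp
    have hprime : p.IsPrime := hmin.1.1
    let ι : MvPolynomial (Fin s) K →ₐ[K] FractionRing (MvPolynomial (Fin s) K ⧸ p) :=
      (IsScalarTower.toAlgHom K (MvPolynomial (Fin s) K ⧸ p) _).comp (Ideal.Quotient.mkₐ K p)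
    have hker : RingHom.ker ι = p := by
      ext f
      rw [RingHom.mem_ker]
      change algebraMap (MvPolynomial (Fin s) K ⧸ p) _ (Ideal.Quotient.mk p f) = 0 ↔ _
      rw [map_eq_zero_iff _ (IsFractionRing.injective _ _), Ideal.Quotient.eq_zero_iff_mem]
    obtain ⟨M, hM, hle⟩ := exists_idealOfGroupAlgebra_le_ker ι
      (fun i h => hX i (hker ▸ (RingHom.mem_ker.mpr h))) (hker.symm ▸ hmin.1.2) q hsec hx hxπ hΛ
    rw [hker] at hle
    exact ⟨⟨M, hM⟩, trivial, le_antisymm hle (hmin.2 ⟨isPrime_idealOfGroupAlgebra M,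
      latticeIdeal_le_idealOfGroupAlgebra hΛk hΛπ M⟩ hle)⟩
  calc P.ncard ≤ _ := Set.ncard_le_ncard hsub (Set.toFinite _)
    _ ≤ _ := Set.ncard_image_le (Set.toFinite _)
    _ = Nat.card (PrimeSpectrum (AddMonoidAlgebra K Γ)) := Set.ncard_univ _
    _ ≤ Nat.card Γ := hcard.trans_eq hrank

/-- The ideal of `K[t_1, …, t_s]` given by a character of `Γ` with values in `K`. -/
noncomputable def idealOfCharacter (k : Fin s → ℕ) (π : (Fin s → ℤ) →+ Γ)
    (χ : Multiplicative Γ →* Kˣ) : Ideal (MvPolynomial (Fin s) K) :=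
  RingHom.ker (latticeAeval (K := K) k ((Units.coeHom K).comp (χ.comp π.toMultiplicative)))

theorem isPrime_idealOfCharacter (χ : Multiplicative Γ →* Kˣ) :
    (idealOfCharacter k π χ).IsPrime := RingHom.ker_isPrime _

theorem latticeIdeal_le_idealOfCharacter (hk : ∀ a ∈ Λ, weightForm k a = 0)
    (hπ : ∀ a ∈ Λ, π a = 0) (χ : Multiplicative Γ →* Kˣ) :
    latticeIdeal K Λ ≤ idealOfCharacter k π χ := by
  refine latticeIdeal_le_ker_latticeAeval hk fun a ha => ?_
  change ((χ (Multiplicative.ofAdd (π a)) : Kˣ) : K) = 1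
  rw [hπ a ha, ofAdd_zero, map_one, Units.val_one]

theorem eq_zero_of_aeval_X_mem_idealOfCharacter {i : Fin s} (hk : 0 < k i)
    {χ : Multiplicative Γ →* Kˣ} {f : Polynomial K}
    (hf : Polynomial.aeval (X i) f ∈ idealOfCharacter k π χ) : f = 0 := by
  by_contra hne
  exact nonZeroDivisors.ne_zero (latticeAeval_aeval_X_mem_nonZeroDivisors _ hk hne) hf

theorem idealOfCharacter_injective (hsec : ∀ g, ∃ a, π a = g ∧ weightForm k a = 0) :
    Function.Injective (idealOfCharacter (K := K) k π) := by
  intro χ χ' h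
  refine MonoidHom.ext fun g => Units.ext ?_
  obtain ⟨a, ha, hka⟩ := hsec g.toAdd
  let c : K := (χ g : Kˣ)
  -- The binomial `t^{a⁺} - c t^{a⁻}`, with `a` of weight zero over `g`, detects the value of a
  -- character at `g`.
  have key : ∀ ξ : Multiplicative Γ →* Kˣ,
      monomial (posExponent a) 1 - monomial (posExponent (-a)) c ∈ idealOfCharacter k π ξ ↔
        ((ξ g : Kˣ) : K) = c := by
    intro ξ
    have hw : ∑ i, posExponent a i * k i = ∑ i, posExponent (-a) i * k i := by
      rw [← exponentVector_posExponent_sub a, map_sub, sub_eq_zero, ← sum_mul_eq_weightForm,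
        ← sum_mul_eq_weightForm] at hka
      exact_mod_cast hka
    have hY : ξ (Multiplicative.ofAdd (π (exponentVector (posExponent a)))) =
        ξ g * ξ (Multiplicative.ofAdd (π (exponentVector (posExponent (-a))))) := by
      have : π (exponentVector (posExponent a)) =
          g.toAdd + π (exponentVector (posExponent (-a))) := by
        rw [← sub_eq_iff_eq_add, ← map_sub, exponentVector_posExponent_sub, ha]
      rw [this, ofAdd_add, map_mul]
      rfl
    rw [idealOfCharacter, RingHom.mem_ker, map_sub, latticeAeval_monomial, latticeAeval_monomial,
      sub_eq_zero, hw]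
    change Polynomial.monomial _ ((1 : K) •
        ((ξ (Multiplicative.ofAdd (π (exponentVector (posExponent a)))) : Kˣ) : K)) =
      Polynomial.monomial _ (c •
        ((ξ (Multiplicative.ofAdd (π (exponentVector (posExponent (-a))))) : Kˣ) : K)) ↔ _
    rw [(Polynomial.monomial_injective _).eq_iff, hY, one_smul, Units.val_mul, smul_eq_mul]
    exact mul_left_inj' (Units.ne_zero _)
  exact (((key χ').mp (h ▸ (key χ).mpr rfl))).symm

/-- With `|Γ|` invertible in `K`, there are enough roots of unity for `Γ` to have exactly `|Γ|`
characters. -/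
theorem card_le_ncard_of_isAlgClosed [IsAlgClosed K] [Finite Γ] (hΓ : (Nat.card Γ : K) ≠ 0)
    (hsec : ∀ g, ∃ a, π a = g ∧ weightForm k a = 0)
    {P : Set (Ideal (MvPolynomial (Fin s) K))} (hfin : P.Finite)
    (hP : ∀ χ : Multiplicative Γ →* Kˣ, idealOfCharacter k π χ ∈ P) : Nat.card Γ ≤ P.ncard := by
  have hexp : NeZero (Monoid.exponent (Multiplicative Γ) : K) := by
    refine ⟨fun h => hΓ ?_⟩
    obtain ⟨c, hc⟩ := Group.exponent_dvd_nat_card (G := Multiplicative Γ)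
    have hc' : Nat.card Γ = Monoid.exponent (Multiplicative Γ) * c := hc
    rw [hc', Nat.cast_mul, h, zero_mul]
  have hcard : Nat.card (Multiplicative Γ →* Kˣ) = Nat.card Γ :=
    CommGroup.card_monoidHom_of_hasEnoughRootsOfUnity (Multiplicative Γ) K
  rw [← hcard, ← Set.ncard_univ,
    ← Set.ncard_image_of_injective _ (idealOfCharacter_injective (K := K) hsec)]
  refine Set.ncard_le_ncard ?_ hfin
  rintro _ ⟨χ, -, rfl⟩
  exact hP χ

end Counting

/-! ### The torsion group and its prime-to-`p` part -/

section TorsionGroup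

/-- Project along `x` onto the vectors of weight zero, then reduce modulo `Λ`: the weight-zero
classes are precisely the torsion classes. -/
theorem exists_torsion_projection {s : ℕ} {Λ : AddSubgroup (Fin s → ℤ)} {k : Fin s → ℕ}
    (hk : ∀ a ∈ Λ, weightForm k a = 0)
    (hsat : ∀ a, weightForm k a = 0 → ∃ N : ℕ, 0 < N ∧ N • a ∈ Λ)
    {x : Fin s → ℤ} (hx : weightForm k x = 1) :
    ∃ π : (Fin s → ℤ) →+ latticeTorsion Λ, (∀ a, a ∈ Λ ↔ weightForm k a = 0 ∧ π a = 0) ∧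
      (∀ g, ∃ a, π a = g ∧ weightForm k a = 0) ∧ π x = 0 := by
  have hmem : ∀ a, weightForm k a = 0 → QuotientAddGroup.mk' Λ a ∈ latticeTorsion Λ := by
    intro a ha
    obtain ⟨N, hN, h⟩ := hsat a ha
    refine isOfFinAddOrder_iff_nsmul_eq_zero.mpr ⟨N, hN, ?_⟩
    rw [← map_nsmul]
    exact (QuotientAddGroup.eq_zero_iff _).mpr h
  let r : (Fin s → ℤ) →+ (Fin s → ℤ) :=
    AddMonoidHom.id _ - ((zmultiplesHom _ x).comp (weightForm k).toAddMonoidHom)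
  have hr : ∀ a, r a = a - weightForm k a • x := fun a => rfl
  have hr0 : ∀ a, weightForm k (r a) = 0 := fun a => by
    rw [hr, map_sub, map_smul, hx, smul_eq_mul, mul_one, sub_self]
  let π : (Fin s → ℤ) →+ latticeTorsion Λ :=
    ((QuotientAddGroup.mk' Λ).comp r).codRestrict (latticeTorsion Λ) fun a => hmem _ (hr0 a)
  have hπ : ∀ a, weightForm k a = 0 → ((π a : latticeTorsion Λ) : (Fin s → ℤ) ⧸ Λ) =
      QuotientAddGroup.mk' Λ a := by
    intro a ha
    change QuotientAddGroup.mk' Λ (r a) = _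
    rw [hr, ha, zero_smul, sub_zero]
  refine ⟨π, fun a => ⟨fun ha => ⟨hk a ha, ?_⟩, ?_⟩, ?_, ?_⟩
  · refine Subtype.ext ?_
    rw [hπ a (hk a ha)]
    exact (QuotientAddGroup.eq_zero_iff _).mpr ha
  · rintro ⟨ha, h⟩
    rw [← QuotientAddGroup.eq_zero_iff]
    exact (hπ a ha).symm.trans (congrArg Subtype.val h)
  · rintro ⟨g, hg⟩
    obtain ⟨a, rfl⟩ := QuotientAddGroup.mk'_surjective Λ g
    obtain ⟨N, hN, h⟩ := isOfFinAddOrder_iff_nsmul_eq_zero.mp hg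
    rw [← map_nsmul] at h
    have h1 := hk _ ((QuotientAddGroup.eq_zero_iff _).mp h)
    rw [map_nsmul, smul_eq_zero] at h1
    have ha := h1.resolve_left hN.ne'
    exact ⟨a, Subtype.ext (hπ a ha), ha⟩
  · refine Subtype.ext ?_
    change QuotientAddGroup.mk' Λ (r x) = _
    rw [hr, hx, one_smul, sub_self, map_zero]
    rfl

theorem finite_latticeTorsion {s : ℕ} (Λ : AddSubgroup (Fin s → ℤ)) :
    Finite (latticeTorsion Λ) := by
  have hfin : Module.Finite ℤ ((Fin s → ℤ) ⧸ Λ) :=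
    Module.Finite.of_surjective (QuotientAddGroup.mk' Λ).toIntLinearMap
      (QuotientAddGroup.mk'_surjective Λ)
  have : Module.Finite ℤ (AddSubgroup.toIntSubmodule (latticeTorsion Λ)) := inferInstance
  refine @Module.finite_of_fg_torsion (AddSubgroup.toIntSubmodule (latticeTorsion Λ)) _ _ _ ?_
  rintro ⟨y, hy⟩
  obtain ⟨N, hN, h⟩ := isOfFinAddOrder_iff_nsmul_eq_zero.mp hy
  refine ⟨⟨(N : ℤ), mem_nonZeroDivisors_of_ne_zero (by exact_mod_cast hN.ne')⟩, Subtype.ext ?_⟩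
  change (N : ℤ) • y = 0
  rw [natCast_zsmul, h]

/-- The prime-to-`p` part of a finite abelian group is a retract, with `p`-primary kernel. -/
theorem exists_isGreatest_coprime_card {T : Type*} [AddCommGroup T] [Finite T] {p : ℕ}
    (hp : p.Prime) :
    ∃ G : AddSubgroup T, IsGreatest {H : AddSubgroup T | (Nat.card H).Coprime p} G ∧
      ∃ ρ : T →+ G, (∀ g : G, ρ g = g) ∧ ∀ t, ρ t = 0 → ∃ r : ℕ, p ^ r • t = 0 := by
  obtain ⟨r, n, hpn, hcard⟩ := Nat.exists_eq_pow_mul_and_not_dvd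
    (Nat.card_pos (α := T)).ne' p hp.ne_one
  have hcop : n.Coprime (p ^ r) := ((hp.coprime_iff_not_dvd.mpr hpn).pow_left r).symm
  -- With `e ≡ 1` mod `n` and `e ≡ 0` mod `p^r`, multiplication by `e` is the projection onto the
  -- `n`-torsion `G`.
  obtain ⟨e, he1, he0⟩ := Nat.chineseRemainder hcop 1 0
  have hT : ∀ t : T, (p ^ r * n) • t = 0 := fun t => by
    rw [← hcard]
    exact card_nsmul_eq_zero'
  let G : AddSubgroup T := (nsmulAddMonoidHom (α := T) n).ker
  have hG : ∀ t, t ∈ G ↔ n • t = 0 := fun t => Iff.rfl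
  have heG : ∀ t ∈ G, e • t = t := by
    intro t ht
    have h := nsmul_eq_nsmul_iff_modEq.mpr
      (he1.of_dvd (addOrderOf_dvd_of_nsmul_eq_zero ((hG t).mp ht)))
    rwa [one_nsmul] at h
  obtain ⟨c, hc⟩ := (Nat.modEq_zero_iff_dvd).mp he0
  have heT : ∀ t, e • t ∈ G := by
    intro t
    rw [hG, ← mul_nsmul', hc, show n * (p ^ r * c) = c * (p ^ r * n) by ring, mul_nsmul', hT,
      nsmul_zero]
  refine ⟨G, ⟨?_, ?_⟩, (nsmulAddMonoidHom (α := T) e).codRestrict G heT, ?_, ?_⟩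
  · change (Nat.card G).Coprime p
    rw [Nat.coprime_comm, hp.coprime_iff_not_dvd]
    intro hdvd
    have := Fact.mk hp
    obtain ⟨g, hg⟩ := exists_prime_addOrderOf_dvd_card' p hdvd
    refine hpn (hg ▸ addOrderOf_dvd_of_nsmul_eq_zero (Subtype.ext ?_))
    exact (hG g).mp g.2
  · intro H hH t ht
    -- The order of `n • t` divides both `p^r` and `|H|`, which are coprime.
    rw [hG, ← AddMonoid.addOrderOf_eq_one_iff]
    have h1 : addOrderOf (n • t) ∣ p ^ r := by
      refine addOrderOf_dvd_of_nsmul_eq_zero ?_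
      rw [← mul_nsmul', hT]
    have h2 : addOrderOf (n • t) ∣ Nat.card H := by
      refine addOrderOf_dvd_of_nsmul_eq_zero ?_
      have h3 : Nat.card H • (⟨t, ht⟩ : H) = 0 := card_nsmul_eq_zero'
      have h4 : Nat.card H • t = 0 := congrArg Subtype.val h3
      rw [nsmul_left_comm, h4, nsmul_zero]
    have hH' : (Nat.card H).Coprime (p ^ r) := Nat.Coprime.pow_right r hH
    exact Nat.dvd_one.mp (hH' ▸ Nat.dvd_gcd h2 h1)
  · rintro ⟨g, hg⟩
    exact Subtype.ext (heG g hg)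
  · intro t ht
    have h0 : e • t = 0 := congrArg Subtype.val ht
    refine ⟨r, ?_⟩
    have h1 : p ^ r • t ∈ G := by
      rw [hG, ← mul_nsmul', mul_comm, hT]
    rw [← heG _ h1, nsmul_left_comm, h0, nsmul_zero]

end TorsionGroup

/-! ### Primes containing `I` and a variable -/

section IrrelevantIdeal

variable {s : ℕ} {K : Type*} [Field K]

theorem irrelevantIdeal_eq_ker : irrelevantIdeal K s = RingHom.ker (constantCoeff (σ := Fin s) (R := K)) := by
  ext f
  rw [irrelevantIdeal, ← Set.image_univ, mem_ideal_span_X_image, RingHom.mem_ker,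
    constantCoeff_eq]
  constructor
  · intro h
    by_contra hne
    obtain ⟨i, -, hi⟩ := h 0 (mem_support_iff.mpr hne)
    exact hi rfl
  · intro h u hu
    by_contra! hne
    have : u = 0 := Finsupp.ext fun i => hne i trivial
    rw [this, mem_support_iff] at hu
    exact hu h

theorem isMaximal_irrelevantIdeal : (irrelevantIdeal K s).IsMaximal := by
  rw [irrelevantIdeal_eq_ker]
  exact RingHom.ker_isMaximal_of_surjective _ fun c => ⟨C c, constantCoeff_C _ c⟩

theorem latticeIdeal_le_irrelevantIdeal {Λ : AddSubgroup (Fin s → ℤ)} {k : Fin s → ℕ}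
    (hk : ∀ i, 0 < k i) (hΛ : ∀ a ∈ Λ, weightForm k a = 0) :
    latticeIdeal K Λ ≤ irrelevantIdeal K s := by
  have hle := latticeIdeal_le_ker_latticeAeval (K := K) (A := K) (Y := 1) hΛ fun _ _ => rfl
  have h : (Polynomial.evalRingHom (0 : K)).comp
      (latticeAeval (K := K) (A := K) k 1).toRingHom = constantCoeff := by
    refine MvPolynomial.ringHom_ext (fun c => ?_) fun i => ?_
    · simp only [RingHom.comp_apply, AlgHom.toRingHom_eq_coe, RingHom.coe_coe, constantCoeff_C]
      rw [← MvPolynomial.algebraMap_eq, AlgHom.commutes]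
      simp
    · simp [latticeAeval, (hk i).ne']
  intro f hf
  rw [irrelevantIdeal_eq_ker, RingHom.mem_ker, ← h, RingHom.comp_apply]
  have hf' : (latticeAeval (K := K) (A := K) k 1) f = 0 := hle hf
  change Polynomial.evalRingHom 0 ((latticeAeval (K := K) (A := K) k 1) f) = 0
  rw [hf', map_zero]

/-- Let `x` have coordinate 0 at the variables in `Q` and 1 elsewhere. A binomial in `Q` has both
monomials in `Q` or neither, so `x` is a zero of `I`; some `t_i ∈ Q`, so `x ∈ V(I, t_i) = {0}`. No
extension of `K` is needed. -/
theorem eq_irrelevantIdeal_of_prod_mem {m : ℕ} {L : Matrix (Fin s) (Fin m) ℤ}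
    (hV : ∀ i : Fin s, zeroLocus K (matrixIdeal K L ⊔ Ideal.span {X i}) = {0})
    {Q : Ideal (MvPolynomial (Fin s) K)} (hQ : Q.IsPrime) (hle : matrixIdeal K L ≤ Q)
    (hmem : ∏ i, X i ∈ Q) : Q = irrelevantIdeal K s := by
  classical
  obtain ⟨i, -, hi⟩ := (Ideal.IsPrime.prod_mem_iff (p := Q)).mp hmem
  let x : Fin s → K := fun l => if X l ∈ Q then 0 else 1
  have hx : ∀ u : Fin s → ℕ, aeval (R := K) x (∏ l, X l ^ u l : MvPolynomial (Fin s) K) =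
      if (∏ l, X l ^ u l : MvPolynomial (Fin s) K) ∈ Q then 0 else 1 := by
    intro u
    simp only [map_prod, map_pow, aeval_X]
    split_ifs with h
    · obtain ⟨l, hl, hlQ⟩ := (Ideal.IsPrime.prod_mem_iff (p := Q)).mp h
      refine Finset.prod_eq_zero hl ?_
      have hul : u l ≠ 0 := by
        intro h0
        rw [h0, pow_zero] at hlQ
        exact hQ.ne_top ((Ideal.eq_top_iff_one _).mpr hlQ)
      simp [x, hQ.mem_of_pow_mem _ hlQ, hul]
    · refine Finset.prod_eq_one fun l hl => ?_
      by_cases hul : u l = 0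
      · rw [hul, pow_zero]
      · have : X l ∉ Q := fun hlQ => h ((Ideal.IsPrime.prod_mem_iff (p := Q)).mpr
          ⟨l, hl, Ideal.pow_mem_of_mem _ hlQ _ (Nat.pos_of_ne_zero hul)⟩)
        simp [x, this]
  have hzero : x ∈ zeroLocus K (matrixIdeal K L ⊔ Ideal.span {X i}) := by
    have : matrixIdeal K L ⊔ Ideal.span {X i} ≤ RingHom.ker (aeval (R := K) x) := by
      rw [sup_le_iff, matrixIdeal, Ideal.span_le, Set.range_subset_iff,
        Ideal.span_singleton_le_iff_mem]
      constructor
      · intro j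
        have hj : vectorBinomial K (L.col j) ∈ Q := hle (Ideal.subset_span ⟨j, rfl⟩)
        rw [SetLike.mem_coe, RingHom.mem_ker, vectorBinomial, map_sub, hx, hx, sub_eq_zero]
        rw [vectorBinomial] at hj
        congr 1
        rw [eq_iff_iff]
        exact ⟨fun h => by simpa using Q.sub_mem h hj, fun h => by simpa using Q.add_mem hj h⟩
      · simp [RingHom.mem_ker, x, hi]
    rw [mem_zeroLocus_iff]
    exact fun f hf => this hf
  rw [hV i] at hzero
  have hX : irrelevantIdeal K s ≤ Q := by
    refine Ideal.span_le.mpr ?_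
    rintro _ ⟨l, rfl⟩
    by_contra hl
    have h0 : x l = 0 := congrFun hzero l
    simp only [x] at h0
    rw [if_neg (show X l ∉ Q from hl)] at h0
    exact one_ne_zero h0
  exact (isMaximal_irrelevantIdeal.eq_of_le hQ.ne_top hX).symm

end IrrelevantIdeal

/-! ### Height of primes over the lattice ideal -/

section LatticeHeight

variable {s : ℕ} {K : Type*} [Field K]

theorem exponentVector_single (i : Fin s) (n : ℕ) :
    exponentVector (Finsupp.single i n) = Pi.single i (n : ℤ) := by
  ext j
  simp only [exponentVector_apply, Finsupp.single_apply, Pi.single_apply, eq_comm (a := i)]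
  split_ifs <;> simp

theorem height_eq_of_latticeIdeal_le (hs : 0 < s) {Λ : AddSubgroup (Fin s → ℤ)} {k : Fin s → ℕ}
    (hk : ∀ i, 0 < k i) (hsat : ∀ a, weightForm k a = 0 → ∃ N : ℕ, 0 < N ∧ N • a ∈ Λ)
    {p : Ideal (MvPolynomial (Fin s) K)} [p.IsPrime] (hle : latticeIdeal K Λ ≤ p)
    (h0 : ∀ f : Polynomial K,
      Polynomial.aeval (X ⟨0, hs⟩ : MvPolynomial (Fin s) K) f ∈ p → f = 0) :
    p.height = ((s - 1 : ℕ) : ℕ∞) := by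
  obtain ⟨n, rfl⟩ : ∃ n, s = n + 1 := ⟨s - 1, by omega⟩
  refine MvPolynomial.height_eq_of_pow_sub_pow_mem p h0 fun i => ?_
  -- The vector `k_0 e_i - k_i e_0` has weight zero, so a multiple lies in `Λ` and gives `t_i^{N
  -- k_0} - t_0^{N k_i} ∈ p`.
  obtain ⟨N, hN, hNΛ⟩ := hsat (Pi.single i (k 0 : ℤ) - Pi.single 0 (k i : ℤ)) (by
    rw [map_sub, weightForm_single, weightForm_single, mul_comm, sub_self])
  refine ⟨N * k 0, Nat.mul_pos hN (hk 0), N * k i, ?_⟩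
  rw [X_pow_eq_monomial, X_pow_eq_monomial]
  refine hle (monomial_sub_mem_latticeIdeal ?_)
  rw [exponentVector_single, exponentVector_single]
  convert! hNΛ using 1
  rw [nsmul_sub, ← Pi.single_smul, ← Pi.single_smul]
  push_cast
  simp

end LatticeHeight

/-! ### Assembly of the main theorem -/

theorem proposition5p6 {K : Type*} [Field K] {s m : ℕ} (hs : 0 < s)
    (L : Matrix (Fin s) (Fin m) ℤ)
    (hgraded : IsGradedIdeal (matrixIdeal K L))
    (hV : ∀ i : Fin s, zeroLocus K (matrixIdeal K L ⊔ Ideal.span {X i}) = {0}) :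
    let I : Ideal (MvPolynomial (Fin s) K) := matrixIdeal K L
    let 𝔪 : Ideal (MvPolynomial (Fin s) K) := irrelevantIdeal K s
    let Λ : AddSubgroup (Fin s → ℤ) := columnLattice L
    let h : MvPolynomial (Fin s) K := ∏ i, X i
    -- `t = {𝔮_1, …, 𝔮_c}`, `c = t.card`, `𝔭_i = (𝔮_i).radical`
    ∃ t : Finset (Ideal (MvPolynomial (Fin s) K)), t.Nonempty ∧
      -- (a)
      ((∀ q ∈ t, q.IsPrimary ∧ q.radical.height = ((s - 1 : ℕ) : ℕ∞)) ∧
        (IsUnmixedIdeal I → Submodule.IsMinimalPrimaryDecomposition I t) ∧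
        (¬ IsUnmixedIdeal I → ∃ q, IsMinimalDecompositionWith I t 𝔪 q)) ∧
      -- (b)
      (latticeIdeal K Λ = idealSaturation I h ∧
        (∀ g ∈ 𝔪, (∀ q ∈ t, g ∉ q.radical) → latticeIdeal K Λ = idealSaturation I g) ∧
        latticeIdeal K Λ = t.inf id ∧
        latticeIdeal K Λ = idealHull I) ∧
      -- (c)
      (L.rank = s - 1 ∧
        ∃! P : Ideal (MvPolynomial (Fin s) K), IsHerzogIdeal P ∧ I ≤ P) ∧
      -- (d)
      (¬ IsUnmixedIdeal I → ∃ a : ℕ, 0 < a ∧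
        latticeIdeal K Λ = I.colon {h ^ a} ∧
        IsMinimalDecompositionWith I t 𝔪 (I ⊔ Ideal.span {h ^ a}) ∧
        I = latticeIdeal K Λ ⊓ (I ⊔ Ideal.span {h ^ a})) ∧
      -- (e)
      (Finite (latticeTorsion Λ) ∧
        (CharZero K →
          t.card ≤ Nat.card (latticeTorsion Λ) ∧
          (IsAlgClosed K → t.card = Nat.card (latticeTorsion Λ))) ∧
        (∀ p : ℕ, p.Prime → CharP K p →
          ∃ G : AddSubgroup (latticeTorsion Λ),
            IsGreatest {H : AddSubgroup (latticeTorsion Λ) | (Nat.card H).Coprime p} G ∧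
            t.card ≤ Nat.card G ∧
            (IsAlgClosed K → t.card = Nat.card G))) := by
  intro I 𝔪 Λ h
  obtain ⟨d, hd, hhom⟩ := hgraded
  have hdL : ∀ j, weightForm d (L.col j) = 0 := weightForm_col_eq_zero hhom
  obtain ⟨k, hk, hkL, x, hx⟩ := exists_primitive_weight hs hd hdL
  have hkΛ : ∀ a ∈ Λ, weightForm k a = 0 := fun a => weightForm_eq_zero_of_mem_columnLattice hkL
  have hsat : ∀ a, weightForm k a = 0 → ∃ N : ℕ, 0 < N ∧ N • a ∈ Λ := fun a =>
    exists_nsmul_mem_columnLattice hV hk hkL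
  obtain ⟨π, hπ, hsec, hπx⟩ := exists_torsion_projection hkΛ hsat hx
  have hfin : Finite (latticeTorsion Λ) := finite_latticeTorsion Λ
  let J := latticeIdeal K Λ
  have hIJ : I ≤ J := matrixIdeal_le_latticeIdeal L
  have hJ : J = idealSaturation I h := latticeIdeal_eq_idealSaturation hk hπ
  have hM : 𝔪.IsMaximal := isMaximal_irrelevantIdeal
  have hJM : J ≤ 𝔪 := latticeIdeal_le_irrelevantIdeal hk hkΛ
  -- The components are those of `J`, not of `I`; the `𝔪`-primary one is added only if `I ≠ J`.
  obtain ⟨t, ht⟩ := Submodule.IsLasker.exists_isMinimalPrimaryDecomposition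
    (Submodule.isLasker (MvPolynomial (Fin s) K) (MvPolynomial (Fin s) K)) J
  have hvar : ∀ q ∈ t, ∀ i, ∀ f : Polynomial K,
      Polynomial.aeval (X i : MvPolynomial (Fin s) K) f ∈ Ideal.radical q → f = 0 :=
    fun q hq i f hf => eq_zero_of_aeval_X_mem_associatedPrime hk hπ
      (ht.mem_associatedPrimes_quotient_iff.mpr ⟨q, hq, rfl⟩) i hf
  have hX : ∀ q ∈ t, ∀ i, X i ∉ Ideal.radical q := fun q hq i hi =>
    Polynomial.X_ne_zero (hvar q hq i Polynomial.X (by simpa using hi))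
  have hJt : ∀ q ∈ t, J ≤ q := fun q hq => ht.inf_eq.symm.le.trans (Finset.inf_le hq)
  have hprime : ∀ q ∈ t, (Ideal.radical q).IsPrime := fun q hq =>
    Ideal.isPrime_radical (ht.primary hq)
  have htn : ∀ q ∈ t, (Ideal.radical q).height = ((s - 1 : ℕ) : ℕ∞) := by
    intro q hq
    have := hprime q hq
    exact height_eq_of_latticeIdeal_le hs hk hsat ((hJt q hq).trans Ideal.le_radical)
      (hvar q hq _)
  have hcontains : ∀ Q : Ideal (MvPolynomial (Fin s) K), Q.IsPrime → J ≤ Q →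
      ∃ q ∈ t, Ideal.radical q ≤ Q := by
    intro Q hQ hle
    obtain ⟨q, hq, hqQ⟩ := (Ideal.IsPrime.inf_le' hQ).mp (ht.inf_eq.le.trans hle)
    exact ⟨q, hq, hQ.radical_le_iff.mpr hqQ⟩
  have hMn : Ideal.height 𝔪 ≠ ((s - 1 : ℕ) : ℕ∞) := by
    obtain ⟨q, hq, hle⟩ := hcontains 𝔪 hM.isPrime hJM
    have := hprime q hq
    intro h𝔪
    have heq := Ideal.eq_of_le_of_height_le _ hle (h𝔪.trans (htn q hq).symm).le
    exact hX q hq ⟨0, hs⟩ (heq ▸ Ideal.subset_span ⟨_, rfl⟩)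
  have htne : t.Nonempty := ht.nonempty fun htop => hM.ne_top (top_le_iff.mp (htop ▸ hJM))
  have hh𝔪 : h ∈ 𝔪 := (Ideal.IsPrime.prod_mem_iff (hp := hM.isPrime)).mpr
    ⟨⟨0, hs⟩, Finset.mem_univ _, Ideal.subset_span ⟨_, rfl⟩⟩
  have hrad : ∀ Q : Ideal (MvPolynomial (Fin s) K), Q.IsPrime → I ≤ Q → h ∈ Q → Q = 𝔪 :=
    fun Q => eq_irrelevantIdeal_of_prod_mem hV
  obtain ⟨a, ha, hcolon⟩ := exists_colon_eq_idealSaturation I h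
  have hIM : I ≤ 𝔪 := hIJ.trans hJM
  have hQrad : (I ⊔ Ideal.span {h ^ a}).radical = 𝔪 := radical_sup_span_pow_eq hIM hh𝔪 hrad ha
  have hQprim : (I ⊔ Ideal.span {h ^ a}).IsPrimary := isPrimary_sup_span_pow hIM hh𝔪 hrad ha
  have hIeq : I = J ⊓ (I ⊔ Ideal.span {h ^ a}) := hJ ▸ eq_saturation_inf_sup_span hcolon ha
  have hwith : I ≠ J → IsMinimalDecompositionWith I t 𝔪 (I ⊔ Ideal.span {h ^ a}) := fun hne =>
    ht.isMinimalDecompositionWith htn hMn hQprim hQrad hne hIeq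
  have hunmixed : IsUnmixedIdeal I ↔ I = J := by
    refine ⟨fun hun => ?_, fun heq => heq ▸ ht.isUnmixedIdeal htn⟩
    by_contra hne
    exact (hwith hne).not_isUnmixedIdeal htne htn hMn hun
  let P : Set (Ideal (MvPolynomial (Fin s) K)) := Ideal.radical '' (t : Set (Ideal _))
  have hPcard : P.ncard = t.card := by
    rw [Set.InjOn.ncard_image fun q hq q' hq' => ht.eq_of_radical_eq hq hq', Set.ncard_coe_finset]
  have hPmin : ∀ p ∈ P, p ∈ J.minimalPrimes ∧ ∀ i, X i ∉ p := by
    rintro _ ⟨q, hq, rfl⟩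
    refine ⟨⟨⟨hprime q hq, (hJt q hq).trans Ideal.le_radical⟩, ?_⟩, hX q hq⟩
    rintro Q ⟨hQ, hJQ⟩ hle
    obtain ⟨q', hq', hq'Q⟩ := hcontains Q hQ hJQ
    rwa [← ht.radical_le_imp_eq htn hq' hq (hq'Q.trans hle)]
  have hPchar : ∀ {Γ : Type} [AddCommGroup Γ] (π' : (Fin s → ℤ) →+ Γ), (∀ a ∈ Λ, π' a = 0) →
      ∀ χ : Multiplicative Γ →* Kˣ, idealOfCharacter k π' χ ∈ P := by
    intro Γ _ π' hπ' χ
    have hχ := isPrime_idealOfCharacter (k := k) (π := π') χ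
    have hle := latticeIdeal_le_idealOfCharacter (K := K) hkΛ hπ' χ
    -- The character prime contains the radical of a component; equal heights force equality.
    obtain ⟨q, hq, hqle⟩ := hcontains _ hχ hle
    have := hprime q hq
    have hht := height_eq_of_latticeIdeal_le hs hk hsat hle
      fun f hf => eq_zero_of_aeval_X_mem_idealOfCharacter (hk _) hf
    exact ⟨q, hq, Ideal.eq_of_le_of_height_le _ hqle (hht.trans (htn q hq).symm).le⟩
  refine ⟨t, htne, ⟨fun q hq => ⟨ht.primary hq, htn q hq⟩, ?_, ?_⟩, ⟨hJ, ?_, ht.inf_eq.symm, ?_⟩,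
    ⟨rank_eq_of_zeroLocus hs hV hd hdL, existsUnique_herzogIdeal hs hV hd hdL⟩, ?_, hfin, ?_, ?_⟩
  · intro hun
    rw [hunmixed.mp hun]
    exact ht
  · intro hun
    exact ⟨_, hwith (mt hunmixed.mpr hun)⟩
  · exact fun g hg hgt => eq_idealSaturation_of_mem_of_notMem ht hQrad hIeq hg hgt
  · by_cases heq : I = J
    · exact eq_idealHull ht htn hMn hJM (heq.symm ▸ ht) subset_rfl fun q hq => Or.inl hq
    · refine eq_idealHull ht htn hMn hJM (hwith heq).2.2.2 (Finset.subset_insert _ _) fun q hq => ?_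
      rcases Finset.mem_insert.mp hq with rfl | hq
      · exact Or.inr hQrad
      · exact Or.inl hq
  · intro hun
    exact ⟨a, ha, hJ.trans hcolon, hwith (mt hunmixed.mpr hun), hIeq⟩
  · intro hchar
    have hπΛ : ∀ a ∈ Λ, π a = 0 := fun a ha => ((hπ a).mp ha).2
    rw [← hPcard]
    have hle := ncard_le_card_of_minimal (K := K) 1 hkΛ hπΛ hsec hx hπx
      (fun a h1 h2 => ⟨0, by simpa using (hπ a).mpr ⟨h1, h2⟩⟩) P hPmin
    refine ⟨hle, fun _ => le_antisymm hle (card_le_ncard_of_isAlgClosed (K := K)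
      (Nat.cast_ne_zero.mpr Nat.card_pos.ne') hsec (t.finite_toSet.image _) (hPchar π hπΛ))⟩
  · intro p hp hchar
    have : Fact p.Prime := ⟨hp⟩
    obtain ⟨G, hG, ρ, hρ, hρker⟩ := exists_isGreatest_coprime_card (T := latticeTorsion Λ) hp
    have hπΛ : ∀ a ∈ Λ, ρ.comp π a = 0 := fun a ha => by
      rw [AddMonoidHom.comp_apply, ((hπ a).mp ha).2, map_zero]
    have hsecG : ∀ g, ∃ a, ρ.comp π a = g ∧ weightForm k a = 0 := fun g => by
      obtain ⟨a, ha, hka⟩ := hsec g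
      exact ⟨a, by rw [AddMonoidHom.comp_apply, ha, hρ], hka⟩
    have hker : ∀ a, weightForm k a = 0 → ρ.comp π a = 0 → ∃ r : ℕ, p ^ r • a ∈ Λ := by
      intro a h1 h2
      obtain ⟨r, hr⟩ := hρker _ h2
      refine ⟨r, (hπ _).mpr ⟨?_, ?_⟩⟩
      · rw [map_nsmul, h1, smul_zero]
      · rw [map_nsmul, hr]
    -- Applied to `ρ ∘ π`, whose weight-zero kernel exceeds `Λ` only by elements with a `p`-power
    -- multiple in `Λ`.
    have hle := ncard_le_card_of_minimal (K := K) p hkΛ hπΛ hsecG hx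
      (by rw [AddMonoidHom.comp_apply, hπx, map_zero]) hker P hPmin
    refine ⟨G, hG, ?_⟩
    rw [← hPcard]
    refine ⟨hle, fun _ => le_antisymm hle (card_le_ncard_of_isAlgClosed (K := K) ?_ hsecG
      (t.finite_toSet.image _) (hPchar _ hπΛ))⟩
    rw [Ne, CharP.cast_eq_zero_iff K p]
    exact hp.coprime_iff_not_dvd.mp (Nat.coprime_comm.mp hG.1)
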